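/- Let $c\ge 1$ and $\gamma>0$, and put $T_k=(c-1)c^{k-1}$ for $k\ge 1$, $\lambda_j=\gamma c^{2-j}$ for $j\ge 1$ and $p_K=2^{-K}$ for $K\ge 1$. The critical Tokunaga branching process $S^{\mathrm{Tok}}(t;c,\gamma)$ is the continuous-time multi-type branching process that starts with a single root branch, of order $K$ with probability $p_K$, and evolves as follows: independently of all other branches, a branch of order $j$ produces offspring branches of order $i$, for each $1\le i<j$, at rate $\lambda_j T_{j-i}$, and it terminates at rate $\lambda_j$; on termination, a branch of order $j\ge 2$ splits into two branches of order $j-1$, and a branch of order $1$ leaves no offspring. Its branching history is (almost surely) a finite rooted binary tree $T$ with edge lengths, in which the length of an edge is the time between the two events at its ends. The Horton–Strahler order of a leaf is $1$, and that of a vertex whose two offspring have orders $i$ and $j$ is $\max(i,j)+\delta_{ij}$, where $\delta_{ij}$ is the Kronecker delta. The order of an edge is the order of its end farther from the root, and the order $\mathbf k(T)$ of the tree is the order of the edge at the root. For $K\ge 1$, let $T$ be the random tree generated by $S^{\mathrm{Tok}}(t;c,\gamma)$, conditioned on $\mathbf k(T)=K$. Regard $T$ as a metric space (with the path-length distance).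 Given $T$, let $u$ be a point of $T$ sampled uniformly, i.e. from the length measure (Lebesgue measure on each edge) normalized to total mass one, and let $r_u[K]$ be the order of the edge to which $u$ belongs. Then, for every $k\ge 1$, $$\lim_{K\to\infty}\mathbb P\bigl(r_u[K]=k\bigr)=p_k=2^{-k}.$$ -/

import Mathlib

open MeasureTheory ProbabilityTheory Filter Topology
open scoped ENNReal

namespace TreeProcess

/-! ### Binary trees with edge lengths -/

/-- Nonempty finite planted reduced binary trees with edge lengths. Each tree is given with the
length `ℓ` of its root edge (the edge between the root and the vertex closest to it); that vertex is
either a leaf or the parent of exactly two further edges, the root edges of `a` and `b`.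
A tree without planar embedding is represented by any of its embeddings; orders, lengths and the
length measure below do not depend on which of `a`, `b` comes first. -/
inductive LengthTree : Type
  | leaf (ℓ : ℝ) : LengthTree
  | node (ℓ : ℝ) (a b : LengthTree) : LengthTree

namespace LengthTree

/-- The Horton-Strahler order of a tree, by hierarchical counting: a leaf has order `1`, a vertex
whose offspring have orders `i`, `j` has order `max i j` if `i ≠ j` and `i + 1` if `i = j`. -/
def order : LengthTree → ℕ
  | leaf _ => 1
  | node _ a b => if a.order = b.order then a.order + 1 else max a.order b.order

/-- The edges of a tree (`none` is the root edge of a tree of the form `node ℓ a b`). -/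
def Edge : LengthTree → Type
  | leaf _ => Unit
  | node _ a b => Option (a.Edge ⊕ b.Edge)

/-- The length of an edge. -/
def edgeLength : (t : LengthTree) → t.Edge → ℝ
  | leaf ℓ, _ => ℓ
  | node ℓ _ _, none => ℓ
  | node _ a _, some (Sum.inl e) => a.edgeLength e
  | node _ _ b, some (Sum.inr e) => b.edgeLength e

/-- The Horton-Strahler order of an edge, i.e. of the subtree that has this edge as root edge. -/
def edgeOrder : (t : LengthTree) → t.Edge → ℕ
  | leaf ℓ, _ => (leaf ℓ).order
  | node ℓ a b, none => (node ℓ a b).order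
  | node _ a _, some (Sum.inl e) => a.edgeOrder e
  | node _ _ b, some (Sum.inr e) => b.edgeOrder e

/-- The points of the tree as a metric space, except the root: a point lies on a unique edge `e`,
at a distance in `(0, length e]` from the parental end of `e`. (Each vertex other than the root is
the far end of its parental edge, and belongs to this edge.) -/
abbrev Point (t : LengthTree) : Type :=
  Σ e : t.Edge, Set.Ioc (0 : ℝ) (t.edgeLength e)

/-- The length measure of the tree: Lebesgue measure on each edge. -/
noncomputable def lengthMeasure (t : LengthTree) : Measure t.Point :=
  Measure.sum fun e => Measure.map (Sigma.mk e) (Measure.comap Subtype.val (volume : Measure ℝ))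

/-- The uniform distribution on the tree: length measure normalized to total mass one. -/
noncomputable def uniformMeasure (t : LengthTree) : Measure t.Point :=
  (t.lengthMeasure Set.univ)⁻¹ • t.lengthMeasure

/-- The order of the edge to which a point belongs. -/
def pointOrder (t : LengthTree) (u : t.Point) : ℕ := t.edgeOrder u.1

end LengthTree

/-! ### Hierarchical branching processes -/

/-- The parameters `({T_k}, {λ_j}, {p_K})` of a hierarchical branching process. Only `T k`, `k ≥ 1`,
and `rate j`, `j ≥ 1`, matter. -/
structure Params where
  /-- Tokunaga coefficients -/
  T : ℕ → ℝ
  /-- termination rates of branches -/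
  rate : ℕ → ℝ
  /-- distribution of the order of the root branch -/
  p : PMF ℕ
  T_nonneg : ∀ k, 0 ≤ T k
  rate_pos : ∀ j, 0 < rate j
  p_zero : p 0 = 0

namespace Params

variable (P : Params)

/-- The rates of the events in the life of a branch of order `j`. Event `0` is the termination of
the branch, with rate `λ_j`; event `i`, for `1 ≤ i < j`, is the production of an offspring of order
`i`, with rate `λ_j T_{j-i}`. -/
noncomputable def eventRate (j i : ℕ) : ℝ :=
  if i = 0 then P.rate j else if i < j then P.rate j * P.T (j - i) else 0

/-- The total rate of the events in the life of a branch of order `j`. -/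
noncomputable def totalRate (j : ℕ) : ℝ := ∑ i ∈ Finset.range (j + 1), P.eventRate j i

theorem eventRate_nonneg (j i : ℕ) : 0 ≤ P.eventRate j i := by
  unfold eventRate
  split_ifs
  · exact (P.rate_pos j).le
  · exact mul_nonneg (P.rate_pos j).le (P.T_nonneg _)
  · exact le_rfl

theorem totalRate_pos (j : ℕ) : 0 < P.totalRate j := by
  refine Finset.sum_pos' (fun i _ => P.eventRate_nonneg j i) ⟨0, by simp, ?_⟩
  simpa [eventRate] using P.rate_pos j

/-- The law of the next event of a branch of order `j`: the probabilities are proportional to the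
rates. -/
noncomputable def eventPMF (j : ℕ) : PMF ℕ :=
  PMF.ofFinset (fun i => ENNReal.ofReal (P.eventRate j i / P.totalRate j)) (Finset.range (j + 1))
    (by
      rw [← ENNReal.ofReal_sum_of_nonneg
        (fun i _ => div_nonneg (P.eventRate_nonneg j i) (P.totalRate_pos j).le),
        ← Finset.sum_div, ← totalRate, div_self (P.totalRate_pos j).ne', ENNReal.ofReal_one])
    (by
      intro i hi
      have h : ¬ i < j + 1 := by simpa using hi
      have h0 : i ≠ 0 := by omega
      have h1 : ¬ i < j := by omega
      simp [eventRate, h0, h1])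

/-- The law of the pair (waiting time, next event) of a branch of order `j`: the waiting time until
the next event is exponential with the total rate, and independent of what this event is. -/
noncomputable def markLaw (j : ℕ) : Measure (ℝ × ℕ) :=
  (expMeasure (P.totalRate j)).prod (P.eventPMF j).toMeasure

instance (j : ℕ) : IsProbabilityMeasure (P.markLaw j) := by
  have := isProbabilityMeasure_expMeasure (P.totalRate_pos j)
  unfold markLaw
  infer_instance

end Params

/-- The marks that drive the process: for every genealogical address `v` and every order `j`, the
waiting time and the next event that apply if there is a branch segment of order `j` at `v`. -/
abbrev Marks : Type := List Bool × ℕ → ℝ × ℕ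

/-- `Generates m v j t`: the segment at address `v` of a branch of order `j` evolves, under the
marks `m`, into the finite tree `t`. The segment lasts for its waiting time, which is the length of
the corresponding edge. Then, according to the event that occurs,
* a branch of order `1` terminates without leaving offspring;
* a branch of order `j ≥ 2` terminates and splits into two branches of order `j - 1`;
* the branch produces an offspring of order `i` with `1 ≤ i < j`, and itself continues. -/
inductive Generates (m : Marks) : List Bool → ℕ → LengthTree → Prop
  | terminate (v : List Bool) (h : (m (v, 1)).2 = 0) :
      Generates m v 1 (LengthTree.leaf (m (v, 1)).1)
  | split (v : List Bool) (j : ℕ) (a b : LengthTree) (hj : 2 ≤ j) (h : (m (v, j)).2 = 0)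
      (ha : Generates m (false :: v) (j - 1) a) (hb : Generates m (true :: v) (j - 1) b) :
      Generates m v j (LengthTree.node (m (v, j)).1 a b)
  | offspring (v : List Bool) (j i : ℕ) (a b : LengthTree) (hi : 1 ≤ i) (hij : i < j)
      (h : (m (v, j)).2 = i)
      (ha : Generates m (false :: v) j a) (hb : Generates m (true :: v) i b) :
      Generates m v j (LengthTree.node (m (v, j)).1 a b)

/-- The marks determine the tree. -/
theorem Generates.unique {m : Marks} {v : List Bool} {j : ℕ} {t t' : LengthTree}
    (h : Generates m v j t) (h' : Generates m v j t') : t = t' := by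
  induction h generalizing t' with
  | terminate v h => cases h' <;> first | rfl | omega
  | split v j a b hj h ha hb iha ihb =>
    cases h' with
    | terminate => omega
    | split _ _ a' b' _ _ ha' hb' => rw [iha ha', ihb hb']
    | offspring => omega
  | offspring v j i a b hi hij h ha hb iha ihb =>
    cases h' with
    | terminate => omega
    | split => omega
    | offspring _ _ i' a' b' _ _ h' ha' hb' =>
      obtain rfl : i = i' := h.symm.trans h'
      rw [iha ha', ihb hb']

namespace Params

variable (P : Params)

/-- The sample space of the process: the order of the root branch, and the marks. -/
abbrev Sample : Type := ℕ × Marks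

/-- The law of the process: the order of the root branch has law `p`, and all marks are
independent of it and of each other. -/
noncomputable def law : Measure Sample :=
  P.p.toMeasure.prod (Measure.infinitePi fun x : List Bool × ℕ => P.markLaw x.2)

open Classical in
/-- The random tree `T[S]` generated by the branching history of the process (`none` if the
branching history never ends). -/
noncomputable def tree (ω : Sample) : Option LengthTree :=
  if h : ∃ t, Generates ω.2 [] ω.1 t then some h.choose else none

/-- The event that the random tree has order `K`. -/
def orderEvent (K : ℕ) : Set Sample := {ω | ∃ t, tree ω = some t ∧ t.order = K}

/-- The probability that a uniformly sampled point `u` of the random tree, conditioned on having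
order `K`, belongs to an edge of order `k`: the random tree is sampled from its conditional law, and
given the tree, `u` is sampled from the uniform distribution on it. -/
noncomputable def probPointOrder (K k : ℕ) : ℝ≥0∞ :=
  ∫⁻ ω, (tree ω).elim 0 (fun t => t.uniformMeasure {u | t.pointOrder u = k})
    ∂(ProbabilityTheory.cond P.law (orderEvent K))

end Params

/-- The geometric distribution `p_K = 2 ^ (-K)`, `K ≥ 1`. -/
noncomputable def geometricHalf : PMF ℕ :=
  ⟨fun K => if K = 0 then 0 else (2 : ℝ≥0∞)⁻¹ ^ K, by
    have h : ∑' K : ℕ, (if K = 0 then 0 else (2 : ℝ≥0∞)⁻¹ ^ K) = 1 := by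
      rw [tsum_eq_zero_add' ENNReal.summable]
      simpa [ENNReal.inv_mul_cancel] using ENNReal.tsum_geometric_add_one (2 : ℝ≥0∞)⁻¹
    exact h ▸ ENNReal.summable.hasSum⟩

/-- The critical Tokunaga branching process with parameters `c ≥ 1`, `γ > 0`:
`T_k = (c - 1) c^(k-1)`, `λ_j = γ c^(2-j)`, `p_K = 2^(-K)`. -/
noncomputable def criticalTokunaga (c γ : ℝ) (hc : 1 ≤ c) (hγ : 0 < γ) : Params where
  T k := (c - 1) * c ^ (k - 1)
  rate j := γ * c ^ (2 - (j : ℤ))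
  p := geometricHalf
  T_nonneg k := mul_nonneg (by linarith) (by positivity)
  rate_pos j := mul_pos hγ (zpow_pos (by linarith) _)
  p_zero := rfl

end TreeProcess

/-! Write `L` for the total length of the tree and `A` for the length of its edges of order `k`,
both started from one branch of order `K`. The sampling probability is the mean of `A / L`, so it
suffices that `A - 2 ^ (-k) * L` is small against `L` with high probability.

Condition on the first event. For a sum of segment lengths weighted by order, first and second
moments then satisfy recursions in the order. In the critical Tokunaga process every branch has the
same total event rate `γ * c`, and the Tokunaga coefficients are geometric, so these recursions
become first order in the increments, with factor `2 * c` (`IsAdditive.increment_succ`,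
`IsAdditive.sq_increment_succ`). The mean of `L` thus grows like `(2 * c) ^ K`. For `A - 2 ^ (-k) *
L` the mean is constant from order `k` on, which removes the source of the second moment recursion:
the second moment is only `O((2 * c) ^ K)`, not of order `(2 * c) ^ (2 * K)`
(`IsAdditive.exists_integral_sq_le_of_balanced`).

It remains to exclude a small `L`. The Laplace transform of `L` at order `i + 1` is at most the
square of the one at order `i`, so a bound `11 / 12` at one order becomes `(11 / 12) ^ 2 ^ n` at `n`
orders higher (`IsAdditive.integral_exp_neg_le_of_const`). The pointwise inequality
`sq_inv_mul_sub_le` combines the two estimates: take `n` large, then let `K - n` tend to infinity.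
-/

namespace TreeProcess

/-! ### Independent marks and the decomposition at the first event -/

/-- The marks seen from the vertex `b` below the root address. -/
def subMarks (b : Bool) (m : Marks) : Marks := fun x => m (x.1 ++ [b], x.2)

/-- The order of the first branch segment after the event `a` in the life of a branch of order
`j`. -/
def leftOrder (j a : ℕ) : ℕ := if a = 0 then j - 1 else j

/-- The order of the second branch segment after the event `a` in the life of a branch of order
`j`. -/
def rightOrder (j a : ℕ) : ℕ := if a = 0 then j - 1 else a

theorem measurable_subMarks (b : Bool) : Measurable (subMarks b) :=
  measurable_pi_lambda _ fun _ => measurable_pi_apply _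

namespace Params

variable (P : Params)

/-- The law of the marks. -/
noncomputable def marksLaw : Measure Marks :=
  Measure.infinitePi fun x : List Bool × ℕ => P.markLaw x.2

instance : IsProbabilityMeasure P.marksLaw := by
  unfold marksLaw
  infer_instance

/-- Addresses grow at the head, so the first step away from the root is the last letter. Appending
it is an injective reindexing that keeps the order, hence the law, of each coordinate. -/
theorem map_subMarks (b : Bool) : P.marksLaw.map (subMarks b) = P.marksLaw := by
  have hinj : Function.Injective (fun x : List Bool × ℕ => (x.1 ++ [b], x.2)) := by
    rintro ⟨v, i⟩ ⟨w, j⟩ h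
    simpa using h
  exact Measure.map_infinitePi_infinitePi_of_inj
    (P := fun x : List Bool × ℕ => P.markLaw x.2) hinj

theorem indepFun_marks {β γ : Type*} [mβ : MeasurableSpace β] [mγ : MeasurableSpace γ]
    {f : Marks → β} {g : Marks → γ} {S T : Set (List Bool × ℕ)} (hST : Disjoint S T)
    (hf : Measurable[⨆ x ∈ S, MeasurableSpace.comap (fun m : Marks => m x) inferInstance] f)
    (hg : Measurable[⨆ x ∈ T, MeasurableSpace.comap (fun m : Marks => m x) inferInstance] g) :
    IndepFun f g P.marksLaw := by
  have h : iIndepFun (fun (x : List Bool × ℕ) (m : Marks) => m x) P.marksLaw :=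
    iIndepFun_infinitePi (P := fun x : List Bool × ℕ => P.markLaw x.2)
      (X := fun _ y => y) (fun _ => measurable_id)
  have h' := indep_iSup_of_disjoint (fun x => (measurable_pi_apply x).comap_le) h.iIndep hST
  exact indep_of_indep_of_le_left (indep_of_indep_of_le_right h' hg.comap_le) hf.comap_le

theorem measurable_eval_iSup_comap {S : Set (List Bool × ℕ)} {x : List Bool × ℕ} (hx : x ∈ S) :
    Measurable[⨆ x ∈ S, MeasurableSpace.comap (fun m : Marks => m x) inferInstance]
      (fun m : Marks => m x) :=
  measurable_iff_comap_le.2 <| le_iSup₂_of_le x hx le_rfl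

theorem measurable_subMarks_iSup_comap {S : Set (List Bool × ℕ)} (b : Bool)
    (hS : ∀ v i, (v ++ [b], i) ∈ S) :
    Measurable[⨆ x ∈ S, MeasurableSpace.comap (fun m : Marks => m x) inferInstance]
      (subMarks b) :=
  @measurable_pi_lambda _ _ _ (_) _ _ fun _ => measurable_eval_iSup_comap (hS _ _)

/-- The branching property: the root mark and the marks seen from the two vertices below the root
are independent, and each of the latter two has the same law as the full family of marks. -/
theorem measurePreserving_split (j : ℕ) :
    MeasurePreserving (fun m : Marks => (m ([], j), (subMarks false m, subMarks true m)))
      P.marksLaw ((P.markLaw j).prod (P.marksLaw.prod P.marksLaw)) := by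
  have m1 := measurable_subMarks false
  have m2 := measurable_subMarks true
  refine ⟨by fun_prop, ?_⟩
  -- The last letter of an address tells the side of the root on which it lies, so the two families
  -- read disjoint blocks of coordinates; neither reads the empty address.
  have h12 : IndepFun (subMarks false) (subMarks true) P.marksLaw :=
    P.indepFun_marks (S := {x | ∃ v, x.1 = v ++ [false]}) (T := {x | ∃ v, x.1 = v ++ [true]})
      (Set.disjoint_left.2 (by rintro x ⟨v, hv⟩ ⟨w, hw⟩; simp [hv] at hw))
      (measurable_subMarks_iSup_comap _ fun v _ => ⟨v, rfl⟩)
      (measurable_subMarks_iSup_comap _ fun v _ => ⟨v, rfl⟩)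
  have h0 : IndepFun (fun m : Marks => m ([], j))
      (fun m => (subMarks false m, subMarks true m)) P.marksLaw :=
    P.indepFun_marks (S := {x | x.1 = []}) (T := {x | x.1 ≠ []})
      (Set.disjoint_left.2 fun x h h' => h' h)
      (measurable_eval_iSup_comap rfl)
      (@Measurable.prodMk _ _ _ _ _ (_) _ _
        (measurable_subMarks_iSup_comap _ fun v _ => by simp)
        (measurable_subMarks_iSup_comap _ fun v _ => by simp))
  rw [h0.map_prod_eq_prod_map_map (measurable_pi_apply _).aemeasurable (by fun_prop),
    h12.map_prod_eq_prod_map_map (by fun_prop) (by fun_prop), P.map_subMarks, P.map_subMarks]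
  congr 1
  exact Measure.infinitePi_map_eval (fun x : List Bool × ℕ => P.markLaw x.2) ([], j)

/-- The probability that the next event of a branch of order `j` is `a`. -/
noncomputable def eventProb (j a : ℕ) : ℝ := P.eventRate j a / P.totalRate j

theorem eventProb_nonneg (j a : ℕ) : 0 ≤ P.eventProb j a :=
  div_nonneg (P.eventRate_nonneg j a) (P.totalRate_pos j).le

theorem eventProb_zero_pos (j : ℕ) : 0 < P.eventProb j 0 :=
  div_pos (by simpa [eventRate] using P.rate_pos j) (P.totalRate_pos j)

theorem eventPMF_apply (j a : ℕ) : P.eventPMF j a = ENNReal.ofReal (P.eventProb j a) := rfl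

theorem eventProb_eq_zero {j a : ℕ} (hj : 1 ≤ j) (ha : j ≤ a) : P.eventProb j a = 0 := by
  have h0 : a ≠ 0 := by omega
  have h1 : ¬ a < j := by omega
  simp [eventProb, eventRate, h0, h1]

/-- For `j ≥ 1` the event of index `j` has rate zero, so the last term of the defining sum can be
dropped. -/
theorem sum_eventProb {j : ℕ} (hj : 1 ≤ j) : ∑ a ∈ Finset.range j, P.eventProb j a = 1 := by
  have h : ∑ a ∈ Finset.range (j + 1), P.eventProb j a = 1 := by
    unfold eventProb
    rw [← Finset.sum_div, ← totalRate, div_self (P.totalRate_pos j).ne']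
  rwa [Finset.sum_range_succ, P.eventProb_eq_zero hj le_rfl, add_zero] at h

instance (j : ℕ) : IsProbabilityMeasure (expMeasure (P.totalRate j)) :=
  isProbabilityMeasure_expMeasure (P.totalRate_pos j)

theorem lintegral_markLaw {j : ℕ} (hj : 1 ≤ j) {G : ℝ × ℕ → ℝ≥0∞} (hG : Measurable G) :
    ∫⁻ x, G x ∂P.markLaw j = ∑ a ∈ Finset.range j, ENNReal.ofReal (P.eventProb j a) *
      ∫⁻ τ, G (τ, a) ∂expMeasure (P.totalRate j) := by
  rw [markLaw, lintegral_prod_symm' _ hG, lintegral_countable']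
  simp_rw [PMF.toMeasure_apply_singleton _ _ (measurableSet_singleton _), eventPMF_apply]
  rw [tsum_eq_sum (s := Finset.range j)]
  · exact Finset.sum_congr rfl fun a _ => mul_comm _ _
  · intro a ha
    simp [P.eventProb_eq_zero hj (by simpa using ha)]

theorem integral_markLaw {j : ℕ} (hj : 1 ≤ j) {G : ℝ × ℕ → ℝ} (hG : Integrable G (P.markLaw j)) :
    ∫ x, G x ∂P.markLaw j = ∑ a ∈ Finset.range j, P.eventProb j a *
      ∫ τ, G (τ, a) ∂expMeasure (P.totalRate j) := by
  unfold markLaw at hG ⊢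
  rw [integral_prod_symm _ hG, PMF.integral_eq_tsum _ _ hG.integral_prod_right,
    tsum_eq_sum (s := Finset.range j)]
  · refine Finset.sum_congr rfl fun a _ => ?_
    rw [eventPMF_apply, ENNReal.toReal_ofReal (P.eventProb_nonneg j a), smul_eq_mul]
  · intro a ha
    simp [eventPMF_apply, P.eventProb_eq_zero hj (by simpa using ha)]

theorem lintegral_split {j : ℕ} (hj : 1 ≤ j) {H : (ℝ × ℕ) × (Marks × Marks) → ℝ≥0∞}
    (hH : Measurable H) :
    ∫⁻ m, H (m ([], j), (subMarks false m, subMarks true m)) ∂P.marksLaw =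
      ∑ a ∈ Finset.range j, ENNReal.ofReal (P.eventProb j a) *
        ∫⁻ τ, ∫⁻ q, H ((τ, a), q) ∂P.marksLaw.prod P.marksLaw ∂expMeasure (P.totalRate j) := by
  rw [(P.measurePreserving_split j).lintegral_comp hH, lintegral_prod _ hH.aemeasurable,
    P.lintegral_markLaw hj hH.lintegral_prod_right']

theorem integral_split {j : ℕ} (hj : 1 ≤ j) {H : (ℝ × ℕ) × (Marks × Marks) → ℝ}
    (hH : Measurable H)
    (hi : Integrable (fun m => H (m ([], j), (subMarks false m, subMarks true m))) P.marksLaw) :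
    ∫ m, H (m ([], j), (subMarks false m, subMarks true m)) ∂P.marksLaw =
      ∑ a ∈ Finset.range j, P.eventProb j a *
        ∫ τ, ∫ q, H ((τ, a), q) ∂P.marksLaw.prod P.marksLaw ∂expMeasure (P.totalRate j) := by
  have hmp := P.measurePreserving_split j
  have hi' : Integrable H ((P.markLaw j).prod (P.marksLaw.prod P.marksLaw)) := by
    rw [← hmp.map_eq, integrable_map_measure hH.aestronglyMeasurable hmp.aemeasurable]
    exact hi
  rw [← P.integral_markLaw hj hi'.integral_prod_left, ← integral_prod _ hi', ← hmp.map_eq,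
    integral_map hmp.aemeasurable hH.aestronglyMeasurable]

end Params

/-! ### Length measure as a sum over edges -/

namespace LengthTree

/-- The total length of a tree, where an edge of order `j` is weighted by `f j`. -/
noncomputable def weightedLength (f : ℕ → ℝ≥0∞) : LengthTree → ℝ≥0∞
  | leaf ℓ => f 1 * ENNReal.ofReal ℓ
  | node ℓ a b => f (node ℓ a b).order * ENNReal.ofReal ℓ +
      (a.weightedLength f + b.weightedLength f)

theorem tsum_edge (f : ℕ → ℝ≥0∞) (t : LengthTree) :
    ∑' e : t.Edge, f (t.edgeOrder e) * ENNReal.ofReal (t.edgeLength e) = t.weightedLength f := by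
  induction t with
  | leaf ℓ =>
    change ∑' _ : Unit, f 1 * ENNReal.ofReal ℓ = _
    simp [weightedLength]
  | node ℓ a b iha ihb =>
    rw [weightedLength, ← iha, ← ihb]
    refine ((Equiv.optionEquivSumPUnit.{0} (a.Edge ⊕ b.Edge)).symm.tsum_eq _).symm.trans ?_
    rw [Summable.tsum_sum ENNReal.summable ENNReal.summable,
      Summable.tsum_sum ENNReal.summable ENNReal.summable, add_comm]
    congr 1
    exact tsum_fintype _ |>.trans (by simp [edgeOrder, edgeLength])

/-- A general `s` serves both the numerator (`{k}`) and the normalization (`Set.univ`) of the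
uniform measure. -/
theorem lengthMeasure_edgeOrder (s : Set ℕ) [DecidablePred (· ∈ s)] (t : LengthTree) :
    t.lengthMeasure {u | t.edgeOrder u.1 ∈ s} =
      t.weightedLength fun j => if j ∈ s then 1 else 0 := by
  have hms : MeasurableSet {u : t.Point | t.edgeOrder u.1 ∈ s} :=
    MeasurableSpace.measurableSet_iInf.2 fun e => by
      change MeasurableSet {u : Set.Ioc (0 : ℝ) (t.edgeLength e) | t.edgeOrder e ∈ s}
      simp
  have hmk : ∀ e, Measurable
      (Sigma.mk (β := fun e => Set.Ioc (0 : ℝ) (t.edgeLength e)) e) :=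
    fun e _ hs => MeasurableSpace.measurableSet_iInf.1 hs e
  rw [← tsum_edge, lengthMeasure, Measure.sum_apply]
  · refine tsum_congr fun e => ?_
    rw [Measure.map_apply (hmk e)]
    · have hvol : Measure.comap Subtype.val volume
          (Set.univ : Set (Set.Ioc (0 : ℝ) (t.edgeLength e))) =
            ENNReal.ofReal (t.edgeLength e) := by
        rw [comap_subtype_coe_apply measurableSet_Ioc, Subtype.coe_image_univ, Real.volume_Ioc,
          sub_zero]
      by_cases h : t.edgeOrder e ∈ s
      · simp only [Set.preimage_ofPred_eq, h, Set.ofPred_true, hvol, if_true, one_mul]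
      · simp [h]
    · exact hms
  · exact hms

theorem uniformMeasure_pointOrder (t : LengthTree) (k : ℕ) :
    t.uniformMeasure {u | t.pointOrder u = k} =
      (t.weightedLength fun _ => 1)⁻¹ * t.weightedLength fun j => if j = k then 1 else 0 := by
  have h1 := t.lengthMeasure_edgeOrder Set.univ
  have h2 := t.lengthMeasure_edgeOrder {k}
  simp only [Set.mem_univ, Set.ofPred_true, if_true, Set.mem_singleton_iff] at h1 h2
  rw [uniformMeasure, Measure.smul_apply, h1, smul_eq_mul, ← h2]
  rfl

end LengthTree

/-- A split is a tie of two orders `j - 1`, and an offspring has order below `j`, so either way the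
Horton–Strahler order is the label of the branch. Conditioning on the order of the tree is thereby
conditioning on the root label. -/
theorem Generates.order_eq {m : Marks} {v : List Bool} {j : ℕ} {t : LengthTree}
    (h : Generates m v j t) : t.order = j := by
  induction h with
  | terminate => rfl
  | split v j a b hj h ha hb iha ihb =>
    rw [LengthTree.order, iha, ihb, if_pos rfl]
    omega
  | offspring v j i a b hi hij h ha hb iha ihb =>
    rw [LengthTree.order, iha, ihb, if_neg hij.ne', max_eq_left hij.le]

/-! ### Additive functionals on the marks, and finiteness of the tree -/

/-- The marks seen from the vertex `v`. -/
def marksAt (v : List Bool) (m : Marks) : Marks := fun x => m (x.1 ++ v, x.2)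

theorem marksAt_nil (m : Marks) : marksAt [] m = m := by
  ext x <;> simp [marksAt]

theorem marksAt_root (v : List Bool) (m : Marks) (j : ℕ) : marksAt v m ([], j) = m (v, j) := rfl

theorem subMarks_marksAt (b : Bool) (v : List Bool) (m : Marks) :
    subMarks b (marksAt v m) = marksAt (b :: v) m := by
  ext x <;> simp [marksAt, subMarks]

/-- The sum, over the branch segments in the first `n` generations of a process started by one
branch of order `j`, of a weight that depends on the order and the mark of the segment. -/
noncomputable def totalUpTo (w : ℕ → ℝ × ℕ → ℝ≥0∞) : ℕ → Marks → ℕ → ℝ≥0∞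
  | 0, _, _ => 0
  | n + 1, m, j => if j = 0 then 0 else w j (m ([], j)) +
      (totalUpTo w n (subMarks false m) (leftOrder j (m ([], j)).2) +
        totalUpTo w n (subMarks true m) (rightOrder j (m ([], j)).2))

/-- The sum of the weights of all branch segments. -/
noncomputable def total (w : ℕ → ℝ × ℕ → ℝ≥0∞) (m : Marks) (j : ℕ) : ℝ≥0∞ :=
  ⨆ n, totalUpTo w n m j

section total

variable (w : ℕ → ℝ × ℕ → ℝ≥0∞)

/-- Order `0` stands for the absence of a branch: both orders after the termination of a branch of
order `1` are `0`, so leaves need no separate case. -/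
theorem totalUpTo_zero_order (n : ℕ) (m : Marks) : totalUpTo w n m 0 = 0 := by
  cases n <;> simp [totalUpTo]

theorem total_zero_order (m : Marks) : total w m 0 = 0 := by
  simp [total, totalUpTo_zero_order]

theorem totalUpTo_mono (m : Marks) (j : ℕ) : Monotone fun n => totalUpTo w n m j := by
  refine monotone_nat_of_le_succ fun n => ?_
  induction n generalizing m j with
  | zero => exact zero_le
  | succ n ih =>
    rw [totalUpTo, totalUpTo]
    split_ifs
    · exact le_rfl
    · gcongr
      · exact ih _ _
      · exact ih _ _

theorem total_eq {j : ℕ} (hj : 1 ≤ j) (m : Marks) :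
    total w m j = w j (m ([], j)) +
      (total w (subMarks false m) (leftOrder j (m ([], j)).2) +
        total w (subMarks true m) (rightOrder j (m ([], j)).2)) := by
  unfold total
  rw [ENNReal.iSup_add_iSup_of_monotone (totalUpTo_mono w _ _) (totalUpTo_mono w _ _),
    ENNReal.add_iSup, ← (totalUpTo_mono w m j).iSup_nat_add 1]
  refine iSup_congr fun n => ?_
  rw [totalUpTo, if_neg (by omega)]

variable {w}

theorem total_mono {w' : ℕ → ℝ × ℕ → ℝ≥0∞} (h : ∀ j x, w j x ≤ w' j x) (m : Marks) (j : ℕ) :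
    total w m j ≤ total w' m j := by
  refine iSup_mono fun n => ?_
  induction n generalizing m j with
  | zero => exact le_rfl
  | succ n ih =>
    rw [totalUpTo, totalUpTo]
    split_ifs
    · exact le_rfl
    · gcongr
      · exact h _ _
      · exact ih _ _
      · exact ih _ _

theorem measurable_leftOrder (j : ℕ) : Measurable (leftOrder j) := measurable_of_countable _

theorem measurable_rightOrder (j : ℕ) : Measurable (rightOrder j) := measurable_of_countable _

theorem measurable_totalUpTo (hw : ∀ j, Measurable (w j)) (n : ℕ) :
    Measurable fun x : Marks × ℕ => totalUpTo w n x.1 x.2 := by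
  induction n with
  | zero => exact measurable_const
  | succ n ih =>
    refine measurable_from_prod_countable_left fun j => ?_
    simp only [totalUpTo]
    split_ifs
    · exact measurable_const
    · have h0 : Measurable fun m : Marks => m ([], j) := measurable_pi_apply _
      refine ((hw j).comp h0).add (Measurable.add ?_ ?_)
      · exact ih.comp ((measurable_subMarks _).prodMk ((measurable_leftOrder j).comp h0.snd))
      · exact ih.comp ((measurable_subMarks _).prodMk ((measurable_rightOrder j).comp h0.snd))

theorem measurable_total (hw : ∀ j, Measurable (w j)) :
    Measurable fun x : Marks × ℕ => total w x.1 x.2 :=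
  Measurable.iSup fun n => measurable_totalUpTo hw n

end total

/-- The weight of a branch segment that yields the length of a tree, where edges of order `j` are
weighted by `f j`. -/
noncomputable def lengthWeight (f : ℕ → ℝ≥0∞) (j : ℕ) (x : ℝ × ℕ) : ℝ≥0∞ :=
  f j * ENNReal.ofReal x.1

/-- The weight of a branch segment that yields the number of edges; events that cannot occur
have infinite weight. -/
noncomputable def countWeight (j : ℕ) (x : ℝ × ℕ) : ℝ≥0∞ := if x.2 < j then 1 else ∞

theorem measurable_lengthWeight (f : ℕ → ℝ≥0∞) (j : ℕ) : Measurable (lengthWeight f j) := by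
  unfold lengthWeight
  fun_prop

theorem measurable_countWeight (j : ℕ) : Measurable (countWeight j) :=
  (measurable_of_countable fun a : ℕ => if a < j then (1 : ℝ≥0∞) else ∞).comp measurable_snd

theorem Generates.total_lengthWeight (f : ℕ → ℝ≥0∞) {m : Marks} {v : List Bool} {j : ℕ}
    {t : LengthTree} (h : Generates m v j t) :
    total (lengthWeight f) (marksAt v m) j = t.weightedLength f := by
  induction h with
  | terminate v h =>
    rw [total_eq _ le_rfl, marksAt_root, h]
    simp [leftOrder, rightOrder, total_zero_order, lengthWeight, LengthTree.weightedLength]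
  | split v j a b hj h ha hb iha ihb =>
    rw [total_eq _ (by omega), marksAt_root, h, subMarks_marksAt, subMarks_marksAt,
      LengthTree.weightedLength, (Generates.split v j a b hj h ha hb).order_eq, ← iha, ← ihb]
    simp [leftOrder, rightOrder, lengthWeight]
  | offspring v j i a b hi hij h ha hb iha ihb =>
    rw [total_eq _ (by omega), marksAt_root, h, subMarks_marksAt, subMarks_marksAt,
      LengthTree.weightedLength, (Generates.offspring v j i a b hi hij h ha hb).order_eq,
      ← iha, ← ihb]
    simp [leftOrder, rightOrder, lengthWeight, show i ≠ 0 by omega]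

/-- Every segment weighs at least `1`, so the bound drops by one on passing to either child. The
infinite weight rules out events to which no rule of `Generates` applies. -/
theorem exists_generates_of_total_lt (n : ℕ) {m : Marks} {v : List Bool} {j : ℕ} (hj : 1 ≤ j)
    (h : total countWeight (marksAt v m) j < n) : ∃ t, Generates m v j t := by
  induction n generalizing v j with
  | zero => simp at h
  | succ n ih =>
    rw [total_eq _ hj, marksAt_root, subMarks_marksAt, subMarks_marksAt] at h
    have hlt : (m (v, j)).2 < j := by
      by_contra hlt
      simp [countWeight, hlt] at h
    rw [countWeight, if_pos hlt, Nat.cast_succ, add_comm (n : ℝ≥0∞),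
      ENNReal.add_lt_add_iff_left ENNReal.one_ne_top] at h
    have hl := le_self_add.trans_lt h
    have hr := le_add_self.trans_lt h
    by_cases h0 : (m (v, j)).2 = 0
    · simp only [leftOrder, rightOrder, h0, if_true] at hl hr
      rcases hj.eq_or_lt with rfl | hj2
      · exact ⟨_, .terminate v h0⟩
      · obtain ⟨a, ha⟩ := ih (by omega) hl
        obtain ⟨b, hb⟩ := ih (by omega) hr
        exact ⟨_, .split v j a b hj2 h0 ha hb⟩
    · simp only [leftOrder, rightOrder, h0, if_false] at hl hr
      obtain ⟨a, ha⟩ := ih hj hl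
      obtain ⟨b, hb⟩ := ih (by omega) hr
      exact ⟨_, .offspring v j _ a b (by omega) hlt rfl ha hb⟩

theorem exists_generates {m : Marks} {j : ℕ} (hj : 1 ≤ j) (h : total countWeight m j ≠ ∞) :
    ∃ t, Generates m [] j t := by
  obtain ⟨n, hn⟩ := ENNReal.exists_nat_gt h
  exact exists_generates_of_total_lt n hj (by rwa [marksAt_nil])

/-! ### Finiteness of first and second moments -/

theorem le_div_of_le_add_mul {a : ℕ → ℝ≥0∞} {B ρ : ℝ≥0∞} (hρ : ρ < 1) (h0 : a 0 = 0)
    (h : ∀ n, a (n + 1) ≤ B + ρ * a n) (n : ℕ) : a n ≤ B / (1 - ρ) := by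
  induction n with
  | zero => simp [h0]
  | succ n ih =>
    have h1 : B = (1 - ρ) * (B / (1 - ρ)) :=
      (ENNReal.mul_div_cancel (tsub_pos_of_lt hρ).ne' (by simp)).symm
    calc a (n + 1) ≤ B + ρ * (B / (1 - ρ)) := (h n).trans (by gcongr)
      _ = (1 - ρ) * (B / (1 - ρ)) + ρ * (B / (1 - ρ)) := by rw [← h1]
      _ = B / (1 - ρ) := by rw [← add_mul, tsub_add_cancel_of_le hρ.le, one_mul]

namespace Params

variable (P : Params)

theorem sum_ofReal_eventProb {j : ℕ} (hj : 1 ≤ j) :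
    ∑ a ∈ Finset.range j, ENNReal.ofReal (P.eventProb j a) = 1 := by
  rw [← ENNReal.ofReal_sum_of_nonneg fun a _ => P.eventProb_nonneg j a, P.sum_eventProb hj,
    ENNReal.ofReal_one]

theorem sum_ofReal_eventProb_mul_const {j : ℕ} (hj : 1 ≤ j) (C : ℝ≥0∞) :
    ∑ a ∈ Finset.range j, ENNReal.ofReal (P.eventProb j a) * C = C := by
  rw [← Finset.sum_mul, P.sum_ofReal_eventProb hj, one_mul]

/-- A family of quantities that is recursively bounded along the first event of a branch is
bounded. -/
theorem exists_bound (M : ℕ → ℕ → ℝ≥0∞) (B : ℕ → ℝ≥0∞) (h0 : ∀ j, M 0 j = 0)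
    (hz : ∀ n, M n 0 = 0) (hB : ∀ j, 1 ≤ j → B j ≠ ∞)
    (h : ∀ n j, 1 ≤ j → M (n + 1) j ≤ B j + ∑ a ∈ Finset.range j,
      ENNReal.ofReal (P.eventProb j a) * (M n (leftOrder j a) + M n (rightOrder j a))) (j : ℕ) :
    ∃ C, C ≠ ∞ ∧ ∀ n, M n j ≤ C := by
  induction j using Nat.strong_induction_on with
  | _ j ih =>
    rcases Nat.eq_zero_or_pos j with rfl | hj
    · exact ⟨0, by simp, fun n => (hz n).le⟩
    choose! C hC hMC using ih
    set D := ∑ i ∈ Finset.range j, C i with hD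
    have hDtop : D ≠ ∞ := ENNReal.sum_ne_top.2 fun i hi => hC i (Finset.mem_range.1 hi)
    have hMD : ∀ n, ∀ i < j, M n i ≤ D := fun n i hi => (hMC i hi n).trans
      (Finset.single_le_sum (f := C) (fun _ _ => zero_le) (Finset.mem_range.2 hi))
    obtain ⟨i, rfl⟩ : ∃ i, j = i + 1 := ⟨j - 1, by omega⟩
    -- `ρ` is the probability that the first event is not termination. Only then does order `j`
    -- recur, in the continuing branch; all other branches have smaller order and are bounded by
    -- `D`. Termination has positive probability, so `ρ < 1`.
    set ρ := ∑ a ∈ Finset.range i, ENNReal.ofReal (P.eventProb (i + 1) (a + 1)) with hρdef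
    have hsum := P.sum_ofReal_eventProb hj
    rw [Finset.sum_range_succ', ← hρdef] at hsum
    have hq0 : ENNReal.ofReal (P.eventProb (i + 1) 0) ≠ 0 := by
      simpa using P.eventProb_zero_pos (i + 1)
    have hρtop : ρ ≠ ∞ := fun h => by simp [h] at hsum
    have hρ : ρ < 1 := by
      rw [← hsum]
      exact ENNReal.lt_add_right hρtop hq0
    have hq1 : ENNReal.ofReal (P.eventProb (i + 1) 0) ≤ 1 := hsum ▸ le_add_self
    -- One `D` pays for a side branch, `D + D` for the two branches after a split.
    refine ⟨(B (i + 1) + (D + (D + D))) / (1 - ρ), ENNReal.div_ne_top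
      (by simp [hB (i + 1) hj, hDtop]) (tsub_pos_of_lt hρ).ne',
      le_div_of_le_add_mul hρ (h0 _) fun n => ?_⟩
    refine (h n (i + 1) hj).trans ?_
    rw [Finset.sum_range_succ', add_assoc]
    refine add_le_add le_rfl ?_
    have hterm : ∀ a ∈ Finset.range i, ENNReal.ofReal (P.eventProb (i + 1) (a + 1)) *
        (M n (leftOrder (i + 1) (a + 1)) + M n (rightOrder (i + 1) (a + 1))) ≤
        ENNReal.ofReal (P.eventProb (i + 1) (a + 1)) * (M n (i + 1) + D) := fun a ha => by
      have ha' := Finset.mem_range.1 ha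
      simp only [leftOrder, rightOrder, Nat.succ_ne_zero, if_false]
      gcongr
      exact hMD _ _ (by omega)
    calc _ ≤ ρ * (M n (i + 1) + D) + 1 * (D + D) := by
          gcongr
          · rw [hρdef, Finset.sum_mul]
            exact Finset.sum_le_sum hterm
          · exact hMD _ _ (by simp [leftOrder])
          · exact hMD _ _ (by simp [rightOrder])
      _ ≤ ρ * M n (i + 1) + 1 * D + 1 * (D + D) := by
          rw [mul_add]
          exact add_le_add (add_le_add le_rfl (mul_le_mul' hρ.le le_rfl)) le_rfl
      _ = D + (D + D) + ρ * M n (i + 1) := by ring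

theorem lintegral_sq_add {α β : Type*} [MeasurableSpace α] [MeasurableSpace β] {μ : Measure α}
    {ν : Measure β} [IsProbabilityMeasure μ] [IsProbabilityMeasure ν] {f : α → ℝ≥0∞}
    {g : β → ℝ≥0∞} (hf : Measurable f) (hg : Measurable g) (x : ℝ≥0∞) :
    ∫⁻ q, (x + (f q.1 + g q.2)) ^ 2 ∂μ.prod ν =
      x ^ 2 + 2 * x * (∫⁻ y, f y ∂μ + ∫⁻ z, g z ∂ν) + 2 * ((∫⁻ y, f y ∂μ) * ∫⁻ z, g z ∂ν) +
        (∫⁻ y, f y ^ 2 ∂μ + ∫⁻ z, g z ^ 2 ∂ν) := by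
  have h1 : ∀ {φ : α → ℝ≥0∞}, Measurable φ → ∫⁻ q, φ q.1 ∂μ.prod ν = ∫⁻ y, φ y ∂μ :=
    fun hφ => measurePreserving_fst.lintegral_comp hφ
  have h2 : ∀ {φ : β → ℝ≥0∞}, Measurable φ → ∫⁻ q, φ q.2 ∂μ.prod ν = ∫⁻ y, φ y ∂ν :=
    fun hφ => measurePreserving_snd.lintegral_comp hφ
  have hexp : ∀ q : α × β, (x + (f q.1 + g q.2)) ^ 2 =
      x ^ 2 + 2 * x * (f q.1 + g q.2) + 2 * (f q.1 * g q.2) + (f q.1 ^ 2 + g q.2 ^ 2) :=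
    fun q => by ring
  simp_rw [hexp]
  rw [lintegral_add_left (by fun_prop), lintegral_add_left (by fun_prop),
    lintegral_add_left (by fun_prop), lintegral_add_left (by fun_prop),
    lintegral_const_mul _ (by fun_prop), lintegral_const_mul _ (by fun_prop),
    lintegral_add_left (by fun_prop), lintegral_prod_mul (by fun_prop) (by fun_prop),
    h1 hf, h2 hg, h1 (hf.pow_const 2), h2 (hg.pow_const 2)]
  simp

section total

variable {P} {w : ℕ → ℝ × ℕ → ℝ≥0∞} (hw : ∀ j, Measurable (w j))
include hw

theorem measurable_totalUpTo_left (n j : ℕ) : Measurable fun m => totalUpTo w n m j :=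
  (measurable_totalUpTo hw n).comp measurable_prodMk_right

theorem measurable_totalUpTo_node (n j : ℕ) :
    Measurable fun x : (ℝ × ℕ) × (Marks × Marks) => w j x.1 +
      (totalUpTo w n x.2.1 (leftOrder j x.1.2) + totalUpTo w n x.2.2 (rightOrder j x.1.2)) := by
  refine ((hw j).comp measurable_fst).add (Measurable.add ?_ ?_)
  · exact (measurable_totalUpTo hw n).comp (measurable_snd.fst.prodMk
      ((measurable_leftOrder j).comp measurable_fst.snd))
  · exact (measurable_totalUpTo hw n).comp (measurable_snd.snd.prodMk
      ((measurable_rightOrder j).comp measurable_fst.snd))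

theorem lintegral_totalUpTo_succ (n : ℕ) {j : ℕ} (hj : 1 ≤ j) :
    ∫⁻ m, totalUpTo w (n + 1) m j ∂P.marksLaw = ∫⁻ x, w j x ∂P.markLaw j +
      ∑ a ∈ Finset.range j, ENNReal.ofReal (P.eventProb j a) *
        (∫⁻ m, totalUpTo w n m (leftOrder j a) ∂P.marksLaw +
          ∫⁻ m, totalUpTo w n m (rightOrder j a) ∂P.marksLaw) := by
  have h1 : ∀ {φ : Marks → ℝ≥0∞}, Measurable φ →
      ∫⁻ q, φ q.1 ∂P.marksLaw.prod P.marksLaw = ∫⁻ y, φ y ∂P.marksLaw :=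
    fun hφ => measurePreserving_fst.lintegral_comp hφ
  have h2 : ∀ {φ : Marks → ℝ≥0∞}, Measurable φ →
      ∫⁻ q, φ q.2 ∂P.marksLaw.prod P.marksLaw = ∫⁻ y, φ y ∂P.marksLaw :=
    fun hφ => measurePreserving_snd.lintegral_comp hφ
  have hm := fun j => measurable_totalUpTo_left hw n j
  simp only [totalUpTo, if_neg (show ¬ j = 0 by omega)]
  rw [P.lintegral_split hj (measurable_totalUpTo_node hw n j), P.lintegral_markLaw hj (hw j),
    ← Finset.sum_add_distrib]
  refine Finset.sum_congr rfl fun a _ => ?_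
  rw [← mul_add]
  have hwj : Measurable fun τ => w j (τ, a) := (hw j).comp measurable_prodMk_right
  have hinner : ∀ τ, ∫⁻ q, w j (τ, a) + (totalUpTo w n q.1 (leftOrder j a) +
      totalUpTo w n q.2 (rightOrder j a)) ∂P.marksLaw.prod P.marksLaw =
      w j (τ, a) + (∫⁻ m, totalUpTo w n m (leftOrder j a) ∂P.marksLaw +
        ∫⁻ m, totalUpTo w n m (rightOrder j a) ∂P.marksLaw) := fun τ => by
    have hml : Measurable fun q : Marks × Marks => totalUpTo w n q.1 (leftOrder j a) :=
      (hm (leftOrder j a)).comp measurable_fst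
    rw [lintegral_add_left measurable_const, lintegral_add_left hml, h1 (hm _), h2 (hm _)]
    simp
  simp_rw [hinner]
  rw [lintegral_add_left (by fun_prop)]
  simp

theorem lintegral_sq_totalUpTo_succ (n : ℕ) {j : ℕ} (hj : 1 ≤ j) :
    ∫⁻ m, totalUpTo w (n + 1) m j ^ 2 ∂P.marksLaw =
      ∑ a ∈ Finset.range j, ENNReal.ofReal (P.eventProb j a) *
        (∫⁻ τ, w j (τ, a) ^ 2 ∂expMeasure (P.totalRate j) +
          2 * (∫⁻ τ, w j (τ, a) ∂expMeasure (P.totalRate j)) *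
            (∫⁻ m, totalUpTo w n m (leftOrder j a) ∂P.marksLaw +
              ∫⁻ m, totalUpTo w n m (rightOrder j a) ∂P.marksLaw) +
          2 * ((∫⁻ m, totalUpTo w n m (leftOrder j a) ∂P.marksLaw) *
            ∫⁻ m, totalUpTo w n m (rightOrder j a) ∂P.marksLaw) +
          (∫⁻ m, totalUpTo w n m (leftOrder j a) ^ 2 ∂P.marksLaw +
            ∫⁻ m, totalUpTo w n m (rightOrder j a) ^ 2 ∂P.marksLaw)) := by
  have hm := fun j => measurable_totalUpTo_left hw n j
  simp only [totalUpTo, if_neg (show ¬ j = 0 by omega)]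
  rw [P.lintegral_split hj ((measurable_totalUpTo_node hw n j).pow_const 2)]
  refine Finset.sum_congr rfl fun a _ => ?_
  have hwj : Measurable fun τ => w j (τ, a) := (hw j).comp measurable_prodMk_right
  simp_rw [lintegral_sq_add (μ := P.marksLaw) (ν := P.marksLaw) (hm (leftOrder j a))
    (hm (rightOrder j a))]
  rw [lintegral_add_left (by fun_prop), lintegral_add_left (by fun_prop),
    lintegral_add_left (by fun_prop), lintegral_mul_const _ (by fun_prop),
    lintegral_const_mul _ (by fun_prop)]
  simp

theorem exists_bound_lintegral_totalUpTo (hB : ∀ j, 1 ≤ j → ∫⁻ x, w j x ∂P.markLaw j ≠ ∞)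
    (j : ℕ) : ∃ C, C ≠ ∞ ∧ ∀ n, ∫⁻ m, totalUpTo w n m j ∂P.marksLaw ≤ C :=
  P.exists_bound (fun n j => ∫⁻ m, totalUpTo w n m j ∂P.marksLaw)
    (fun j => ∫⁻ x, w j x ∂P.markLaw j) (fun j => by simp [totalUpTo])
    (fun n => by simp [totalUpTo_zero_order]) hB
    (fun n _ hj => (lintegral_totalUpTo_succ hw n hj).le) j

theorem lintegral_total_ne_top (hB : ∀ j, 1 ≤ j → ∫⁻ x, w j x ∂P.markLaw j ≠ ∞) (j : ℕ) :
    ∫⁻ m, total w m j ∂P.marksLaw ≠ ∞ := by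
  obtain ⟨C, hC, h⟩ := exists_bound_lintegral_totalUpTo (P := P) hw hB j
  refine ne_top_of_le_ne_top hC ?_
  unfold total
  rw [lintegral_iSup (fun n => measurable_totalUpTo_left hw n j)
    fun n n' hn m => totalUpTo_mono w m j hn]
  exact iSup_le h

/-- Second moments obey the same recursion as first moments. Its source involves moments of the
weight and products of first moments, which are already bounded uniformly in `n`. -/
theorem lintegral_sq_total_ne_top (hB : ∀ j, 1 ≤ j → ∫⁻ x, w j x ∂P.markLaw j ≠ ∞)
    (hB2 : ∀ j, 1 ≤ j → ∫⁻ x, w j x ^ 2 ∂P.markLaw j ≠ ∞) (j : ℕ) :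
    ∫⁻ m, total w m j ^ 2 ∂P.marksLaw ≠ ∞ := by
  choose C hC h using exists_bound_lintegral_totalUpTo (P := P) hw hB
  have hD : ∀ j, ∃ D, D ≠ ∞ ∧ ∀ i ≤ j, ∀ n, ∫⁻ m, totalUpTo w n m i ∂P.marksLaw ≤ D := fun j =>
    ⟨∑ i ∈ Finset.range (j + 1), C i, ENNReal.sum_ne_top.2 fun i _ => hC i, fun i hi n =>
      (h i n).trans (Finset.single_le_sum (f := C) (fun _ _ => zero_le)
        (Finset.mem_range.2 (by omega)))⟩
  choose D hDtop hD using hD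
  obtain ⟨S, hS, hS'⟩ := P.exists_bound (fun n j => ∫⁻ m, totalUpTo w n m j ^ 2 ∂P.marksLaw)
    (fun j => ∫⁻ x, w j x ^ 2 ∂P.markLaw j + 2 * (∫⁻ x, w j x ∂P.markLaw j) * (D j + D j) +
      2 * (D j * D j)) (fun j => by simp [totalUpTo])
    (fun n => by simp [totalUpTo_zero_order])
    (fun j hj => by
      have h1 := hB j hj
      have h2 := hB2 j hj
      have h3 := hDtop j
      finiteness)
    (fun n j hj => by
      rw [lintegral_sq_totalUpTo_succ hw n hj, P.lintegral_markLaw hj (hw j),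
        P.lintegral_markLaw hj ((hw j).pow_const 2),
        ← P.sum_ofReal_eventProb_mul_const hj (2 * (D j * D j)), Finset.mul_sum, Finset.sum_mul,
        ← Finset.sum_add_distrib, ← Finset.sum_add_distrib, ← Finset.sum_add_distrib]
      refine Finset.sum_le_sum fun a ha => ?_
      have ha' := Finset.mem_range.1 ha
      have hl : leftOrder j a ≤ j := by unfold leftOrder; split_ifs <;> omega
      have hr : rightOrder j a ≤ j := by unfold rightOrder; split_ifs <;> omega
      refine le_of_le_of_eq (b := ENNReal.ofReal (P.eventProb j a) *
        (∫⁻ τ, w j (τ, a) ^ 2 ∂expMeasure (P.totalRate j) +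
          2 * (∫⁻ τ, w j (τ, a) ∂expMeasure (P.totalRate j)) * (D j + D j) + 2 * (D j * D j) +
          (∫⁻ m, totalUpTo w n m (leftOrder j a) ^ 2 ∂P.marksLaw +
            ∫⁻ m, totalUpTo w n m (rightOrder j a) ^ 2 ∂P.marksLaw))) ?_ (by ring)
      gcongr
      · exact hD j _ hl n
      · exact hD j _ hr n
      · exact hD j _ hl n
      · exact hD j _ hr n) j
  refine ne_top_of_le_ne_top hS ?_
  simp_rw [total, ENNReal.iSup_pow]
  rw [lintegral_iSup (fun n => (measurable_totalUpTo_left hw n j).pow_const 2)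
    fun n n' hn m => pow_le_pow_left' (totalUpTo_mono w m j hn) 2]
  exact iSup_le hS'

end total

end Params

/-! ### Moments of the waiting times -/

theorem lintegral_pow_expMeasure {r : ℝ} (hr : 0 < r) (n : ℕ) :
    ∫⁻ τ, ENNReal.ofReal τ ^ n ∂expMeasure r = ENNReal.ofReal (n.factorial / r ^ n) := by
  have hval := Real.integral_rpow_mul_exp_neg_mul_Ioi (a := n + 1) (by positivity) hr
  rw [Real.Gamma_nat_eq_factorial] at hval
  have hpos : (0 : ℝ) < (1 / r) ^ ((n : ℝ) + 1) * n.factorial := by positivity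
  -- A non-integrable function has integral `0` by convention, whereas the Gamma value is positive.
  have hint : IntegrableOn (fun t : ℝ => t ^ ((n : ℝ) + 1 - 1) * Real.exp (-(r * t)))
      (Set.Ioi 0) := by
    by_contra h
    rw [integral_undef h] at hval
    exact hpos.ne hval
  have hind : ∀ τ : ℝ, τ ≠ 0 → (gammaPDF 1 r * fun τ => ENNReal.ofReal τ ^ n) τ =
      (Set.Ioi (0 : ℝ)).indicator (fun t : ℝ => ENNReal.ofReal r *
        ENNReal.ofReal (t ^ ((n : ℝ) + 1 - 1) * Real.exp (-(r * t)))) τ := fun τ hτ => by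
    rcases hτ.lt_or_gt with h | h
    · simp [gammaPDF_of_neg h, h.le]
    · rw [Set.indicator_of_mem (Set.mem_Ioi.2 h), Pi.mul_apply, gammaPDF_of_nonneg h.le,
        ← ENNReal.ofReal_pow h.le, ← ENNReal.ofReal_mul (by positivity),
        ← ENNReal.ofReal_mul hr.le]
      congr 1
      simp
      ring
  rw [expMeasure, gammaMeasure,
    lintegral_withDensity_eq_lintegral_mul _ (f := gammaPDF 1 r)
      (measurable_gammaPDFReal 1 r).ennreal_ofReal
      (by fun_prop),
    lintegral_congr_ae ((Measure.ae_ne volume (0 : ℝ)).mono hind),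
    lintegral_indicator measurableSet_Ioi, lintegral_const_mul _ (by fun_prop),
    ← ofReal_integral_eq_lintegral_ofReal hint
      ((ae_restrict_mem measurableSet_Ioi).mono fun t ht => by
        have := Set.mem_Ioi.1 ht
        positivity), hval, ← ENNReal.ofReal_mul hr.le]
  congr 1
  rw [Real.rpow_add_one (by positivity), Real.rpow_natCast, one_div_pow]
  field_simp

theorem integral_pow_expMeasure {r : ℝ} (hr : 0 < r) (n : ℕ) :
    ∫ τ, (ENNReal.ofReal τ).toReal ^ n ∂expMeasure r = n.factorial / r ^ n := by
  rw [integral_eq_lintegral_of_nonneg_ae (ae_of_all _ fun _ => by positivity)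
    (Measurable.aestronglyMeasurable (by fun_prop))]
  simp_rw [← ENNReal.toReal_pow, ENNReal.ofReal_toReal (ENNReal.pow_ne_top ENNReal.ofReal_ne_top)]
  rw [lintegral_pow_expMeasure hr, ENNReal.toReal_ofReal (by positivity)]

theorem integrable_pow_expMeasure {r : ℝ} (hr : 0 < r) (n : ℕ) :
    Integrable (fun τ => (ENNReal.ofReal τ).toReal ^ n) (expMeasure r) :=
  .of_integral_ne_zero (by rw [integral_pow_expMeasure hr]; positivity)

/-! ### Moment identities for square integrable additive functionals -/

section prod

variable {α β : Type*} [MeasurableSpace α] [MeasurableSpace β] {μ : Measure α}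
  {ν : Measure β} [IsProbabilityMeasure μ] [IsProbabilityMeasure ν] {f : α → ℝ} {g : β → ℝ}

theorem integral_const_add_add (hf : Integrable f μ) (hg : Integrable g ν) (x : ℝ) :
    ∫ q, (x + (f q.1 + g q.2)) ∂μ.prod ν = x + (∫ y, f y ∂μ + ∫ z, g z ∂ν) := by
  rw [integral_add (integrable_const x) ((hf.comp_fst ν).fun_add (hg.comp_snd μ)),
    integral_add (hf.comp_fst ν) (hg.comp_snd μ), integral_fun_fst, integral_fun_snd]
  simp

theorem integral_sq_const_add_add (hf : MemLp f 2 μ) (hg : MemLp g 2 ν) (x : ℝ) :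
    ∫ q, (x + (f q.1 + g q.2)) ^ 2 ∂μ.prod ν =
      x ^ 2 + 2 * x * (∫ y, f y ∂μ + ∫ z, g z ∂ν) + 2 * ((∫ y, f y ∂μ) * ∫ z, g z ∂ν) +
        (∫ y, f y ^ 2 ∂μ + ∫ z, g z ^ 2 ∂ν) := by
  have hf1 := hf.integrable one_le_two
  have hg1 := hg.integrable one_le_two
  have hexp : ∀ q : α × β, (x + (f q.1 + g q.2)) ^ 2 =
      (x ^ 2 + 2 * x * (f q.1 + g q.2)) + (2 * (f q.1 * g q.2) + (f q.1 ^ 2 + g q.2 ^ 2)) :=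
    fun q => by ring
  have hfg := (hf1.comp_fst ν).fun_add (hg1.comp_snd μ)
  have hfg2 := (hf.integrable_sq.comp_fst ν).fun_add (hg.integrable_sq.comp_snd μ)
  simp_rw [hexp]
  rw [integral_add ((integrable_const _).fun_add (hfg.const_mul _))
      (((hf1.mul_prod hg1).const_mul 2).fun_add hfg2),
    integral_add (integrable_const _) (hfg.const_mul _),
    integral_add ((hf1.mul_prod hg1).const_mul 2) hfg2,
    integral_add (hf.integrable_sq.comp_fst ν) (hg.integrable_sq.comp_snd μ),
    integral_const_mul, integral_const_mul, integral_prod_mul,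
    integral_add (hf1.comp_fst ν) (hg1.comp_snd μ), integral_fun_fst, integral_fun_snd,
    integral_fun_fst (fun y => f y ^ 2), integral_fun_snd (fun z => g z ^ 2)]
  simp only [integral_const, probReal_univ, one_smul]
  ring

end prod

/-- Square integrable real functionals of the process that are sums, over the branch segments of
a tree, of the length of the segment times a weight `f j` that depends on its order `j`. -/
structure IsAdditive (P : Params) (f : ℕ → ℝ) (X : Marks → ℕ → ℝ) : Prop where
  measurable : Measurable fun x : Marks × ℕ => X x.1 x.2
  zero_order : ∀ m, X m 0 = 0
  memLp : ∀ j, MemLp (fun m => X m j) 2 P.marksLaw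
  ae_eq : ∀ j, 1 ≤ j → ∀ᵐ m ∂P.marksLaw, X m j = f j * (ENNReal.ofReal (m ([], j)).1).toReal +
    (X (subMarks false m) (leftOrder j (m ([], j)).2) +
      X (subMarks true m) (rightOrder j (m ([], j)).2))

namespace IsAdditive

variable {P : Params} {f : ℕ → ℝ} {X : Marks → ℕ → ℝ} (hX : IsAdditive P f X)
include hX

theorem integrable (j : ℕ) : Integrable (fun m => X m j) P.marksLaw :=
  (hX.memLp j).integrable one_le_two

theorem measurable_node (j : ℕ) :
    Measurable fun x : (ℝ × ℕ) × (Marks × Marks) => f j * (ENNReal.ofReal x.1.1).toReal +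
      (X x.2.1 (leftOrder j x.1.2) + X x.2.2 (rightOrder j x.1.2)) := by
  refine Measurable.add (by fun_prop) (Measurable.add ?_ ?_)
  · exact hX.measurable.comp (measurable_snd.fst.prodMk
      ((measurable_leftOrder j).comp measurable_fst.snd))
  · exact hX.measurable.comp (measurable_snd.snd.prodMk
      ((measurable_rightOrder j).comp measurable_fst.snd))

theorem integral_eq {j : ℕ} (hj : 1 ≤ j) :
    ∫ m, X m j ∂P.marksLaw = f j / P.totalRate j +
      ∑ a ∈ Finset.range j, P.eventProb j a * (∫ m, X m (leftOrder j a) ∂P.marksLaw +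
        ∫ m, X m (rightOrder j a) ∂P.marksLaw) := by
  have h := P.integral_split hj (hX.measurable_node j)
    ((hX.integrable j).congr (hX.ae_eq j hj))
  rw [integral_congr_ae (hX.ae_eq j hj), h]
  have h1 := integral_pow_expMeasure (P.totalRate_pos j) 1
  have h1i := integrable_pow_expMeasure (P.totalRate_pos j) 1
  simp only [pow_one, Nat.factorial_one, Nat.cast_one] at h1 h1i
  have hb : f j / P.totalRate j =
      ∑ a ∈ Finset.range j, P.eventProb j a * (f j / P.totalRate j) := by
    rw [← Finset.sum_mul, P.sum_eventProb hj, one_mul]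
  rw [hb, ← Finset.sum_add_distrib]
  refine Finset.sum_congr rfl fun a _ => ?_
  simp_rw [integral_const_add_add (hX.integrable (leftOrder j a))
    (hX.integrable (rightOrder j a))]
  rw [← mul_add, integral_add (h1i.const_mul _) (integrable_const _), integral_const_mul, h1]
  simp only [integral_const, probReal_univ, one_smul]
  ring

/-- Square the decomposition at the first event: the waiting time has second moment `2 / P.totalRate
j ^ 2`, and the two subtrees are independent given the event. The last sum is kept apart because it
has the kernel of the mean recursion. -/
theorem integral_sq_eq {j : ℕ} (hj : 1 ≤ j) :
    ∫ m, X m j ^ 2 ∂P.marksLaw = ∑ a ∈ Finset.range j, P.eventProb j a *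
      (2 * (f j / P.totalRate j) ^ 2 +
        2 * (f j / P.totalRate j) * (∫ m, X m (leftOrder j a) ∂P.marksLaw +
          ∫ m, X m (rightOrder j a) ∂P.marksLaw) +
        2 * ((∫ m, X m (leftOrder j a) ∂P.marksLaw) * ∫ m, X m (rightOrder j a) ∂P.marksLaw)) +
      ∑ a ∈ Finset.range j, P.eventProb j a * (∫ m, X m (leftOrder j a) ^ 2 ∂P.marksLaw +
        ∫ m, X m (rightOrder j a) ^ 2 ∂P.marksLaw) := by
  have hae : (fun m => X m j ^ 2) =ᵐ[P.marksLaw] _ :=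
    (hX.ae_eq j hj).mono fun m hm => congrArg (· ^ 2) hm
  have h := P.integral_split hj ((hX.measurable_node j).pow_const 2)
    ((hX.memLp j).integrable_sq.congr hae)
  rw [integral_congr_ae hae, h, ← Finset.sum_add_distrib]
  have h1 := integral_pow_expMeasure (P.totalRate_pos j) 1
  have h1i := integrable_pow_expMeasure (P.totalRate_pos j) 1
  have h2 := integral_pow_expMeasure (P.totalRate_pos j) 2
  have h2i := integrable_pow_expMeasure (P.totalRate_pos j) 2
  simp only [pow_one, Nat.factorial_one, Nat.cast_one, Nat.factorial_two, Nat.cast_ofNat]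
    at h1 h1i h2 h2i
  refine Finset.sum_congr rfl fun a _ => ?_
  simp_rw [integral_sq_const_add_add (hX.memLp (leftOrder j a)) (hX.memLp (rightOrder j a)),
    mul_pow]
  rw [integral_add (((h2i.const_mul _).fun_add (
      ((h1i.const_mul _).const_mul 2).mul_const _)).fun_add
      (integrable_const _)) (integrable_const _),
    integral_add ((h2i.const_mul _).fun_add (((h1i.const_mul _).const_mul 2).mul_const _))
      (integrable_const _),
    integral_add (h2i.const_mul _) (((h1i.const_mul _).const_mul 2).mul_const _),
    integral_mul_const, integral_const_mul, integral_const_mul, integral_const_mul, h1, h2]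
  simp only [integral_const, probReal_univ, one_smul]
  ring

end IsAdditive

/-! ### Moment recursions of the critical Tokunaga process -/

section criticalTokunaga

variable {c γ : ℝ} (hc : 1 ≤ c) (hγ : 0 < γ)

/-- With termination, of relative rate `1`, the relative rates at order `i + 1` add up to `c ^ i`;
this cancels the decay of the termination rate `γ * c ^ (1 - i)`. -/
theorem sum_tokunaga (c : ℝ) (i : ℕ) :
    ∑ a ∈ Finset.range i, (c - 1) * c ^ (i - (a + 1)) = c ^ i - 1 := by
  rw [← Finset.sum_range_reflect, ← Finset.mul_sum, mul_comm]
  rw [← geom_sum_mul c i]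
  congr 1
  refine Finset.sum_congr rfl fun a ha => ?_
  have := Finset.mem_range.1 ha
  congr 1
  omega

theorem criticalTokunaga_eventRate_zero (j : ℕ) :
    (criticalTokunaga c γ hc hγ).eventRate j 0 = γ * c ^ (2 - (j : ℤ)) := by
  simp [Params.eventRate, criticalTokunaga]

theorem criticalTokunaga_eventRate_succ {i a : ℕ} (ha : a < i) :
    (criticalTokunaga c γ hc hγ).eventRate (i + 1) (a + 1) =
      γ * c ^ (2 - ((i + 1 : ℕ) : ℤ)) * ((c - 1) * c ^ (i - (a + 1))) := by
  rw [Params.eventRate, if_neg (by omega), if_pos (by omega)]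
  simp only [criticalTokunaga]
  congr 3
  omega

theorem zpow_tokunaga (hc : 1 ≤ c) (i : ℕ) : c ^ (2 - ((i + 1 : ℕ) : ℤ)) * c ^ i = c := by
  rw [← zpow_natCast, ← zpow_add₀ (by positivity)]
  push_cast
  rw [show (2 - ((i : ℤ) + 1) + i) = 1 by ring, zpow_one]

/-- In the critical Tokunaga process, the total rate of the events in the life of a branch does
not depend on its order. -/
theorem criticalTokunaga_totalRate (i : ℕ) :
    (criticalTokunaga c γ hc hγ).totalRate (i + 1) = γ * c := by
  have h0 : (criticalTokunaga c γ hc hγ).eventRate (i + 1) (i + 1) = 0 := by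
    simp [Params.eventRate]
  rw [Params.totalRate, Finset.sum_range_succ, h0, add_zero, Finset.sum_range_succ',
    criticalTokunaga_eventRate_zero, Finset.sum_congr rfl fun a ha =>
      criticalTokunaga_eventRate_succ hc hγ (Finset.mem_range.1 ha), ← Finset.mul_sum,
    sum_tokunaga]
  linear_combination γ * zpow_tokunaga hc i

/-- A branch of order `i + 1` terminates at its next event with probability `c ^ (-i)`. Clearing
this factor leaves weight `1` for termination and the Tokunaga coefficients for offspring. -/
theorem pow_mul_sum_eventProb (i : ℕ) (g : ℕ → ℝ) :
    c ^ i * ∑ a ∈ Finset.range (i + 1),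
      (criticalTokunaga c γ hc hγ).eventProb (i + 1) a * g a =
      g 0 + ∑ a ∈ Finset.range i, (c - 1) * c ^ (i - (a + 1)) * g (a + 1) := by
  have hcpos : 0 < c := by linarith
  have hq : c ^ i * (γ * c ^ (2 - ((i + 1 : ℕ) : ℤ)) / (γ * c)) = 1 := by
    rw [mul_div_assoc', div_eq_one_iff_eq (by positivity)]
    linear_combination γ * zpow_tokunaga hc i
  rw [Finset.sum_range_succ', mul_add, add_comm, Finset.mul_sum]
  congr 1
  · rw [Params.eventProb, criticalTokunaga_totalRate, criticalTokunaga_eventRate_zero,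
      ← mul_assoc, hq, one_mul]
  · refine Finset.sum_congr rfl fun a ha => ?_
    rw [Params.eventProb, criticalTokunaga_totalRate,
      criticalTokunaga_eventRate_succ hc hγ (Finset.mem_range.1 ha), mul_div_right_comm]
    linear_combination ((c - 1) * c ^ (i - (a + 1)) * g (a + 1)) * hq

/-- The contribution of side branches to the linear recursions of the critical Tokunaga process. -/
def sideSum (c : ℝ) (u : ℕ → ℝ) (i : ℕ) : ℝ :=
  ∑ a ∈ Finset.range i, (c - 1) * c ^ (i - (a + 1)) * u (a + 1)

/-- The Tokunaga coefficients are geometric with ratio `c`. This reduces a recursion over all lower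
orders to one of first order. -/
theorem sideSum_succ (c : ℝ) (u : ℕ → ℝ) (i : ℕ) :
    sideSum c u (i + 1) = c * sideSum c u i + (c - 1) * u (i + 1) := by
  rw [sideSum, Finset.sum_range_succ, sideSum, Finset.mul_sum]
  congr 1
  · refine Finset.sum_congr rfl fun a ha => ?_
    have := Finset.mem_range.1 ha
    rw [show i + 1 - (a + 1) = i - (a + 1) + 1 by omega, pow_succ]
    ring
  · simp

theorem pow_mul_sum_eventProb_add (i : ℕ) (u : ℕ → ℝ) :
    c ^ i * ∑ a ∈ Finset.range (i + 1), (criticalTokunaga c γ hc hγ).eventProb (i + 1) a *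
      (u (leftOrder (i + 1) a) + u (rightOrder (i + 1) a)) =
      2 * u i + (c ^ i - 1) * u (i + 1) + sideSum c u i := by
  rw [pow_mul_sum_eventProb hc hγ i fun a => u (leftOrder (i + 1) a) + u (rightOrder (i + 1) a),
    ← sum_tokunaga c i, Finset.sum_mul, add_assoc (2 * u i), sideSum, ← Finset.sum_add_distrib]
  simp only [leftOrder, rightOrder, if_true, Nat.add_sub_cancel, Nat.succ_ne_zero, if_false]
  congr 1
  · ring
  · exact Finset.sum_congr rfl fun a _ => by ring

theorem pow_mul_sum_eventProb_mul (i : ℕ) (u : ℕ → ℝ) :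
    c ^ i * ∑ a ∈ Finset.range (i + 1), (criticalTokunaga c γ hc hγ).eventProb (i + 1) a *
      (u (leftOrder (i + 1) a) * u (rightOrder (i + 1) a)) =
      u i ^ 2 + u (i + 1) * sideSum c u i := by
  rw [pow_mul_sum_eventProb hc hγ i fun a => u (leftOrder (i + 1) a) * u (rightOrder (i + 1) a),
    sideSum, Finset.mul_sum]
  simp only [leftOrder, rightOrder, if_true, Nat.add_sub_cancel, Nat.succ_ne_zero, if_false]
  congr 1
  · ring
  · exact Finset.sum_congr rfl fun a _ => by ring

/-- A linear recursion with the kernel of the critical Tokunaga process is a first-order recursion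
for the increments. -/
theorem increment_succ {c : ℝ} {u b : ℕ → ℝ}
    (h : ∀ i, u (i + 1) = b (i + 1) + 2 * u i + sideSum c u i) (i : ℕ) :
    u (i + 2) - u (i + 1) = 2 * c * (u (i + 1) - u i) + b (i + 2) - c * b (i + 1) := by
  have h1 := h i
  have h2 := h (i + 1)
  rw [sideSum_succ] at h2
  linear_combination h2 - c * h1

variable {hc hγ} {f : ℕ → ℝ} {X : Marks → ℕ → ℝ}
  (hX : IsAdditive (criticalTokunaga c γ hc hγ) f X)
include hX

theorem IsAdditive.integral_succ (i : ℕ) :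
    ∫ m, X m (i + 1) ∂(criticalTokunaga c γ hc hγ).marksLaw =
      c ^ i * f (i + 1) / (γ * c) + 2 * ∫ m, X m i ∂(criticalTokunaga c γ hc hγ).marksLaw +
        sideSum c (fun j => ∫ m, X m j ∂(criticalTokunaga c γ hc hγ).marksLaw) i := by
  have h := hX.integral_eq (Nat.succ_pos i)
  have h1 := pow_mul_sum_eventProb_add hc hγ i
    fun j => ∫ m, X m j ∂(criticalTokunaga c γ hc hγ).marksLaw
  rw [Nat.succ_eq_add_one, criticalTokunaga_totalRate] at h
  linear_combination c ^ i * h + h1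

/-- Eliminating the `sideSum` of the means by the mean recursion completes a square: all
first-moment terms collapse into twice the squared increment of the mean. -/
theorem IsAdditive.integral_sq_succ (i : ℕ) :
    ∫ m, X m (i + 1) ^ 2 ∂(criticalTokunaga c γ hc hγ).marksLaw =
      2 * (∫ m, X m (i + 1) ∂(criticalTokunaga c γ hc hγ).marksLaw -
        ∫ m, X m i ∂(criticalTokunaga c γ hc hγ).marksLaw) ^ 2 +
      2 * ∫ m, X m i ^ 2 ∂(criticalTokunaga c γ hc hγ).marksLaw +
        sideSum c (fun j => ∫ m, X m j ^ 2 ∂(criticalTokunaga c γ hc hγ).marksLaw) i := by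
  have h := hX.integral_sq_eq (Nat.succ_pos i)
  have hm := hX.integral_succ i
  set P := criticalTokunaga c γ hc hγ with hP
  set u : ℕ → ℝ := fun j => ∫ m, X m j ∂P.marksLaw with hu
  set s : ℕ → ℝ := fun j => ∫ m, X m j ^ 2 ∂P.marksLaw with hs
  have h1 : ∑ a ∈ Finset.range (i + 1), P.eventProb (i + 1) a = 1 := P.sum_eventProb (by omega)
  have h2 := pow_mul_sum_eventProb_add hc hγ i u
  have h3 := pow_mul_sum_eventProb_mul hc hγ i u
  have h4 := pow_mul_sum_eventProb_add hc hγ i s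
  rw [← hP] at h2 h3 h4
  have hΛ : P.totalRate (i + 1) = γ * c := criticalTokunaga_totalRate hc hγ i
  set F := f (i + 1) / (γ * c) with hF
  have h5 : s (i + 1) = 2 * F ^ 2 * ∑ a ∈ Finset.range (i + 1), P.eventProb (i + 1) a +
      2 * F * ∑ a ∈ Finset.range (i + 1), P.eventProb (i + 1) a *
        (u (leftOrder (i + 1) a) + u (rightOrder (i + 1) a)) +
      2 * ∑ a ∈ Finset.range (i + 1), P.eventProb (i + 1) a *
        (u (leftOrder (i + 1) a) * u (rightOrder (i + 1) a)) +
      ∑ a ∈ Finset.range (i + 1), P.eventProb (i + 1) a *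
        (s (leftOrder (i + 1) a) + s (rightOrder (i + 1) a)) := by
    rw [Nat.succ_eq_add_one, hΛ, ← hF] at h
    simp only [Finset.mul_sum, ← Finset.sum_add_distrib]
    rw [hs]
    dsimp only
    rw [h, ← Finset.sum_add_distrib]
    exact Finset.sum_congr rfl fun a _ => by simp only [hu]; ring
  have hm' : u (i + 1) = c ^ i * F + 2 * u i + sideSum c u i := by
    rw [hF, mul_div_assoc']
    exact hm
  change s (i + 1) = 2 * (u (i + 1) - u i) ^ 2 + 2 * s i + sideSum c s i
  rw [h1] at h5
  linear_combination c ^ i * h5 + 2 * F * h2 + 2 * h3 + h4 +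
    (-2 * u (i + 1) - 2 * F) * hm'

end criticalTokunaga

namespace IsAdditive

variable {P : Params} {f f' : ℕ → ℝ} {X X' : Marks → ℕ → ℝ}

theorem add (hX : IsAdditive P f X) (hX' : IsAdditive P f' X') :
    IsAdditive P (fun j => f j + f' j) (fun m j => X m j + X' m j) where
  measurable := hX.measurable.add hX'.measurable
  zero_order m := by rw [hX.zero_order, hX'.zero_order, add_zero]
  memLp j := (hX.memLp j).add (hX'.memLp j)
  ae_eq j hj := by
    filter_upwards [hX.ae_eq j hj, hX'.ae_eq j hj] with m h h'
    rw [h, h']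
    ring

theorem const_mul (hX : IsAdditive P f X) (α : ℝ) :
    IsAdditive P (fun j => α * f j) (fun m j => α * X m j) where
  measurable := hX.measurable.const_mul α
  zero_order m := by rw [hX.zero_order, mul_zero]
  memLp j := (hX.memLp j).const_mul α
  ae_eq j hj := by
    filter_upwards [hX.ae_eq j hj] with m h
    rw [h]
    ring

end IsAdditive

/-! ### Tree lengths as additive functionals -/

namespace Params

variable (P : Params) {g : ℕ → ℝ≥0∞}

theorem lintegral_pow_lengthWeight_ne_top (hg : ∀ j, g j ≤ 1) {j : ℕ} (hj : 1 ≤ j) (n : ℕ) :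
    ∫⁻ x, lengthWeight g j x ^ n ∂P.markLaw j ≠ ∞ := by
  rw [P.lintegral_markLaw hj ((measurable_lengthWeight g j).pow_const n)]
  refine ENNReal.sum_ne_top.2 fun a _ => ENNReal.mul_ne_top ENNReal.ofReal_ne_top ?_
  simp only [lengthWeight, mul_pow]
  rw [lintegral_const_mul _ (by fun_prop), lintegral_pow_expMeasure (P.totalRate_pos j)]
  exact ENNReal.mul_ne_top (ENNReal.pow_ne_top ((hg j).trans_lt ENNReal.one_lt_top).ne)
    ENNReal.ofReal_ne_top

theorem lintegral_length_ne_top (hg : ∀ j, g j ≤ 1) (j : ℕ) :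
    ∫⁻ m, total (lengthWeight g) m j ∂P.marksLaw ≠ ∞ :=
  lintegral_total_ne_top (measurable_lengthWeight g)
    (fun j hj => by simpa using P.lintegral_pow_lengthWeight_ne_top hg hj 1) j

theorem measurable_total_right {w : ℕ → ℝ × ℕ → ℝ≥0∞} (hw : ∀ j, Measurable (w j)) (j : ℕ) :
    Measurable fun m => total w m j :=
  (measurable_total hw).comp measurable_prodMk_right

theorem ae_length_ne_top (hg : ∀ j, g j ≤ 1) (j : ℕ) :
    ∀ᵐ m ∂P.marksLaw, total (lengthWeight g) m j ≠ ∞ :=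
  (ae_lt_top (measurable_total_right (measurable_lengthWeight g) j)
    (P.lintegral_length_ne_top hg j)).mono fun _ h => h.ne

theorem ae_count_ne_top (j : ℕ) : ∀ᵐ m ∂P.marksLaw, total countWeight m j ≠ ∞ := by
  refine (ae_lt_top (measurable_total_right measurable_countWeight j) (lintegral_total_ne_top
    measurable_countWeight (fun j hj => ?_) j)).mono fun _ h => h.ne
  rw [P.lintegral_markLaw hj (measurable_countWeight j), Finset.sum_congr rfl
    (g := fun a => ENNReal.ofReal (P.eventProb j a) * 1) fun a ha => by
      simp [countWeight, Finset.mem_range.1 ha], P.sum_ofReal_eventProb_mul_const hj]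
  exact ENNReal.one_ne_top

theorem isAdditive_length (hg : ∀ j, g j ≤ 1) :
    IsAdditive P (fun j => (g j).toReal) (fun m j => (total (lengthWeight g) m j).toReal) where
  measurable := (measurable_total (measurable_lengthWeight g)).ennreal_toReal
  zero_order m := by rw [total_zero_order, ENNReal.toReal_zero]
  memLp j := by
    have hm := measurable_total_right (measurable_lengthWeight g) j
    rw [memLp_two_iff_integrable_sq hm.ennreal_toReal.aestronglyMeasurable]
    simp_rw [← ENNReal.toReal_pow]
    exact integrable_toReal_of_lintegral_ne_top (hm.pow_const 2).aemeasurable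
      (lintegral_sq_total_ne_top (measurable_lengthWeight g)
        (fun j hj => by simpa using P.lintegral_pow_lengthWeight_ne_top hg hj 1)
        (fun j hj => P.lintegral_pow_lengthWeight_ne_top hg hj 2) j)
  ae_eq j hj := by
    -- `ENNReal.toReal` respects sums only of finite terms, so the recursion passes to real numbers
    -- only almost surely.
    filter_upwards [P.ae_length_ne_top hg j] with m hm
    rw [total_eq _ hj] at hm ⊢
    obtain ⟨h1, h2⟩ := ENNReal.add_ne_top.1 hm
    obtain ⟨h3, h4⟩ := ENNReal.add_ne_top.1 h2
    rw [ENNReal.toReal_add h1 h2, ENNReal.toReal_add h3 h4, lengthWeight, ENNReal.toReal_mul]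

end Params

/-! ### Laplace transforms -/

theorem exp_neg_le_quadratic {x : ℝ} (hx : 0 ≤ x) : Real.exp (-x) ≤ 1 - x + x ^ 2 / 2 := by
  have h := Real.quadratic_le_exp_of_nonneg hx
  rw [Real.exp_neg, inv_le_iff_one_le_mul₀ (Real.exp_pos x)]
  -- The point is `(1 - x + x ^ 2 / 2) * (1 + x + x ^ 2 / 2) = 1 + x ^ 4 / 4`.
  nlinarith [sq_nonneg (x - 1), sq_nonneg (x ^ 2)]

namespace IsAdditive

variable {P : Params} {f : ℕ → ℝ} {X : Marks → ℕ → ℝ} (hX : IsAdditive P f X)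
  (hX0 : ∀ m j, 0 ≤ X m j)
include hX hX0

theorem integrable_exp_neg {θ : ℝ} (hθ : 0 ≤ θ) (j : ℕ) :
    Integrable (fun m => Real.exp (-(θ * X m j))) P.marksLaw := by
  refine .of_bound (Measurable.aestronglyMeasurable ?_) 1 (ae_of_all _ fun m => ?_)
  · have := hX.measurable.comp (measurable_prodMk_right (y := j))
    exact Real.measurable_exp.comp (this.const_mul θ).neg
  · rw [Real.norm_eq_abs, Real.abs_exp, Real.exp_le_one_iff, neg_nonpos]
    exact mul_nonneg hθ (hX0 m j)

theorem integral_exp_neg_le_one {θ : ℝ} (hθ : 0 ≤ θ) (j : ℕ) :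
    ∫ m, Real.exp (-(θ * X m j)) ∂P.marksLaw ≤ 1 := by
  calc _ ≤ ∫ _, (1 : ℝ) ∂P.marksLaw :=
        integral_mono (hX.integrable_exp_neg hX0 hθ j) (integrable_const 1) fun m => by
          rw [Real.exp_le_one_iff, neg_nonpos]
          exact mul_nonneg hθ (hX0 m j)
    _ = 1 := by simp

/-- The Laplace transform of a nonnegative additive functional satisfies the inequality that
comes from the split of a branch into two branches of the preceding order. -/
theorem integral_exp_neg_succ_le (hf : ∀ j, 0 ≤ f j) {θ : ℝ} (hθ : 0 ≤ θ) (i : ℕ) :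
    ∫ m, Real.exp (-(θ * X m (i + 1))) ∂P.marksLaw ≤
      (∫ m, Real.exp (-(θ * X m i)) ∂P.marksLaw) ^ 2 := by
  set φ : ℕ → ℝ := fun j => ∫ m, Real.exp (-(θ * X m j)) ∂P.marksLaw with hφ
  have hj : 1 ≤ i + 1 := by omega
  let H : (ℝ × ℕ) × (Marks × Marks) → ℝ := fun x =>
    Real.exp (-(θ * X x.2.1 (leftOrder (i + 1) x.1.2))) *
      Real.exp (-(θ * X x.2.2 (rightOrder (i + 1) x.1.2)))
  have hH : Measurable H := by
    have h1 : Measurable fun x : (ℝ × ℕ) × (Marks × Marks) =>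
        X x.2.1 (leftOrder (i + 1) x.1.2) := hX.measurable.comp
      (measurable_snd.fst.prodMk ((measurable_leftOrder _).comp measurable_fst.snd))
    have h2 : Measurable fun x : (ℝ × ℕ) × (Marks × Marks) =>
        X x.2.2 (rightOrder (i + 1) x.1.2) := hX.measurable.comp
      (measurable_snd.snd.prodMk ((measurable_rightOrder _).comp measurable_fst.snd))
    exact (Real.measurable_exp.comp (h1.const_mul θ).neg).mul
      (Real.measurable_exp.comp (h2.const_mul θ).neg)
  have hHi : Integrable (fun m : Marks => H (m ([], i + 1), (subMarks false m, subMarks true m)))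
      P.marksLaw := by
    refine .of_bound (hH.comp
      (P.measurePreserving_split (i + 1)).measurable).aestronglyMeasurable 1
      (ae_of_all _ fun m => ?_)
    rw [Real.norm_eq_abs, abs_mul, Real.abs_exp, Real.abs_exp]
    refine mul_le_one₀ ?_ (Real.exp_pos _).le ?_
    all_goals
      rw [Real.exp_le_one_iff, neg_nonpos]
      exact mul_nonneg hθ (hX0 _ _)
  -- Dropping the nonnegative length of the root segment leaves a product over the two independent
  -- subtrees.
  have hle : φ (i + 1) ≤ ∑ a ∈ Finset.range (i + 1), P.eventProb (i + 1) a *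
      (φ (leftOrder (i + 1) a) * φ (rightOrder (i + 1) a)) := by
    calc φ (i + 1) ≤ ∫ m, H (m ([], i + 1), (subMarks false m, subMarks true m)) ∂P.marksLaw := by
          refine integral_mono_ae (hX.integrable_exp_neg hX0 hθ (i + 1)) hHi ?_
          filter_upwards [hX.ae_eq (i + 1) hj] with m hm
          simp only [H]
          rw [hm, ← Real.exp_add, Real.exp_le_exp]
          have := mul_nonneg hθ (mul_nonneg (hf (i + 1))
            (ENNReal.toReal_nonneg (a := ENNReal.ofReal (m ([], i + 1)).1)))
          linarith
      _ = _ := by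
          rw [P.integral_split hj hH hHi]
          refine Finset.sum_congr rfl fun a _ => ?_
          simp only [H, hφ]
          rw [integral_prod_mul (fun m => Real.exp (-(θ * X m (leftOrder (i + 1) a))))
            (fun m => Real.exp (-(θ * X m (rightOrder (i + 1) a))))]
          simp
  have h0 : ∀ j, 0 ≤ φ j := fun j => integral_nonneg fun _ => (Real.exp_pos _).le
  have h1 : ∀ j, φ j ≤ 1 := hX.integral_exp_neg_le_one hX0 hθ
  have hsum : ∑ a ∈ Finset.range (i + 1), P.eventProb (i + 1) a = 1 := P.sum_eventProb hj
  rw [Finset.sum_range_succ'] at hle hsum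
  simp only [leftOrder, rightOrder, if_true, Nat.add_sub_cancel, Nat.succ_ne_zero, if_false] at hle
  -- Side branches are discarded by `φ ≤ 1`. With `q` the termination probability this gives `φ (i +
  -- 1) ≤ q * φ i ^ 2 + (1 - q) * φ (i + 1)`, and `q` cancels.
  have hside : ∑ a ∈ Finset.range i, P.eventProb (i + 1) (a + 1) * (φ (i + 1) * φ (a + 1)) ≤
      (∑ a ∈ Finset.range i, P.eventProb (i + 1) (a + 1)) * φ (i + 1) := by
    rw [Finset.sum_mul]
    exact Finset.sum_le_sum fun a _ => mul_le_mul_of_nonneg_left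
      (mul_le_of_le_one_right (h0 _) (h1 _)) (P.eventProb_nonneg _ _)
  have hq := P.eventProb_zero_pos (i + 1)
  rw [← eq_sub_iff_add_eq] at hsum
  rw [hsum] at hside
  refine le_of_mul_le_mul_left ?_ hq
  change P.eventProb (i + 1) 0 * φ (i + 1) ≤ P.eventProb (i + 1) 0 * φ i ^ 2
  linarith

theorem integral_exp_neg_add_le (hf : ∀ j, 0 ≤ f j) {θ : ℝ} (hθ : 0 ≤ θ) (i n : ℕ) :
    ∫ m, Real.exp (-(θ * X m (i + n))) ∂P.marksLaw ≤
      (∫ m, Real.exp (-(θ * X m i)) ∂P.marksLaw) ^ 2 ^ n := by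
  induction n with
  | zero => simp
  | succ n ih =>
    rw [pow_succ 2, pow_mul]
    exact (hX.integral_exp_neg_succ_le hX0 hf hθ (i + n)).trans
      (pow_le_pow_left₀ (integral_nonneg fun _ => (Real.exp_pos _).le) ih 2)

theorem integral_exp_neg_le_quadratic {θ : ℝ} (hθ : 0 ≤ θ) (j : ℕ) :
    ∫ m, Real.exp (-(θ * X m j)) ∂P.marksLaw ≤
      1 - θ * ∫ m, X m j ∂P.marksLaw + θ ^ 2 / 2 * ∫ m, X m j ^ 2 ∂P.marksLaw := by
  have h1 := hX.integrable j
  have h2 := (hX.memLp j).integrable_sq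
  have h3 : Integrable (fun m => 1 - θ * X m j) P.marksLaw :=
    (integrable_const (1 : ℝ)).sub (h1.const_mul θ)
  calc _ ≤ ∫ m, ((1 - θ * X m j) + θ ^ 2 / 2 * X m j ^ 2) ∂P.marksLaw :=
        integral_mono (hX.integrable_exp_neg hX0 hθ j)
          (h3.add (h2.const_mul _)) fun m => by
            have := exp_neg_le_quadratic (mul_nonneg hθ (hX0 m j))
            linarith
    _ = _ := by
      rw [integral_add h3 (h2.const_mul _),
        integral_sub (integrable_const 1) (h1.const_mul θ), integral_const_mul,
        integral_const_mul]
      simp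

end IsAdditive

/-! ### Growth of the total length and of the balanced length -/

section asymptotics

variable {c γ : ℝ} {hc : 1 ≤ c} {hγ : 0 < γ} {f : ℕ → ℝ} {X : Marks → ℕ → ℝ}
  (hX : IsAdditive (criticalTokunaga c γ hc hγ) f X)

include hX

theorem IsAdditive.increment_zero : (∫ m, X m (0 + 1) ∂(criticalTokunaga c γ hc hγ).marksLaw) -
    (∫ m, X m 0 ∂(criticalTokunaga c γ hc hγ).marksLaw) = f 1 / (γ * c) := by
  rw [hX.integral_succ 0]
  simp [sideSum, hX.zero_order]

theorem IsAdditive.increment_succ (i : ℕ) :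
    (∫ m, X m (i + 1 + 1) ∂(criticalTokunaga c γ hc hγ).marksLaw) -
      (∫ m, X m (i + 1) ∂(criticalTokunaga c γ hc hγ).marksLaw) =
      2 * c * ((∫ m, X m (i + 1) ∂(criticalTokunaga c γ hc hγ).marksLaw) -
        (∫ m, X m i ∂(criticalTokunaga c γ hc hγ).marksLaw)) +
          c ^ (i + 1) * (f (i + 2) - f (i + 1)) / (γ * c) := by
  have h := TreeProcess.increment_succ (b := fun i => c ^ (i - 1) * f i / (γ * c))
    (u := fun i => ∫ m, X m i ∂(criticalTokunaga c γ hc hγ).marksLaw) hX.integral_succ i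
  simp only [Nat.add_sub_cancel, show i + 2 - 1 = i + 1 by omega] at h
  linear_combination h

theorem IsAdditive.sq_increment_zero :
    ∫ m, X m (0 + 1) ^ 2 ∂(criticalTokunaga c γ hc hγ).marksLaw =
      2 * ((∫ m, X m (0 + 1) ∂(criticalTokunaga c γ hc hγ).marksLaw) -
        (∫ m, X m 0 ∂(criticalTokunaga c γ hc hγ).marksLaw)) ^ 2 := by
  rw [hX.integral_sq_succ 0]
  simp [sideSum, hX.zero_order]

theorem IsAdditive.sq_increment_succ (i : ℕ) :
    ∫ m, X m (i + 1 + 1) ^ 2 ∂(criticalTokunaga c γ hc hγ).marksLaw -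
      ∫ m, X m (i + 1) ^ 2 ∂(criticalTokunaga c γ hc hγ).marksLaw =
      2 * c * (∫ m, X m (i + 1) ^ 2 ∂(criticalTokunaga c γ hc hγ).marksLaw -
        ∫ m, X m i ^ 2 ∂(criticalTokunaga c γ hc hγ).marksLaw) +
      2 * ((∫ m, X m (i + 1 + 1) ∂(criticalTokunaga c γ hc hγ).marksLaw) -
        (∫ m, X m (i + 1) ∂(criticalTokunaga c γ hc hγ).marksLaw)) ^ 2 - 2 * c *
          ((∫ m, X m (i + 1) ∂(criticalTokunaga c γ hc hγ).marksLaw) -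
            (∫ m, X m i ∂(criticalTokunaga c γ hc hγ).marksLaw)) ^ 2 := by
  have h := TreeProcess.increment_succ
    (b := fun i => 2 * ((∫ m, X m i ∂(criticalTokunaga c γ hc hγ).marksLaw) -
      ∫ m, X m (i - 1) ∂(criticalTokunaga c γ hc hγ).marksLaw) ^ 2)
    (u := fun i => ∫ m, X m i ^ 2 ∂(criticalTokunaga c γ hc hγ).marksLaw) hX.integral_sq_succ i
  simp only [Nat.add_sub_cancel, show i + 2 - 1 = i + 1 by omega] at h
  linear_combination h

theorem IsAdditive.increment_of_const (hf : ∀ j, f j = 1) (i : ℕ) :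
    (∫ m, X m (i + 1) ∂(criticalTokunaga c γ hc hγ).marksLaw) -
      (∫ m, X m i ∂(criticalTokunaga c γ hc hγ).marksLaw) = (2 * c) ^ i / (γ * c) := by
  induction i with
  | zero => rw [hX.increment_zero, hf, pow_zero]
  | succ i ih =>
    rw [hX.increment_succ, ih, hf, hf]
    ring

theorem IsAdditive.integral_sq_le_of_const (hf : ∀ j, f j = 1) (i : ℕ) :
    ∫ m, X m (i + 1) ^ 2 ∂(criticalTokunaga c γ hc hγ).marksLaw ≤
      6 * ((2 * c) ^ i / (γ * c)) ^ 2 := by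
  set d : ℕ → ℝ := fun i => (2 * c) ^ i / (γ * c) with hd
  set s : ℕ → ℝ := fun i => ∫ m, X m i ^ 2 ∂(criticalTokunaga c γ hc hγ).marksLaw with hs
  have hdi : ∀ i, (∫ m, X m (i + 1) ∂(criticalTokunaga c γ hc hγ).marksLaw) -
      (∫ m, X m i ∂(criticalTokunaga c γ hc hγ).marksLaw) = d i := hX.increment_of_const hf
  have hsi : ∀ i, s (i + 2) - s (i + 1) = 2 * c * (s (i + 1) - s i) + 2 * d (i + 1) ^ 2 -
      2 * c * d i ^ 2 := fun i => by
    rw [← hdi, ← hdi]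
    exact hX.sq_increment_succ i
  have hs1 : s 1 = 2 * d 0 ^ 2 := by
    rw [← hdi]
    exact hX.sq_increment_zero
  have hs0 : s 0 = 0 := by simp [hs, hX.zero_order]
  have hdd : ∀ i, d (i + 1) ^ 2 = 4 * c ^ 2 * d i ^ 2 := fun i => by
    simp only [hd]
    ring
  -- The constant `4` is preserved: `2 * c * 4 + 2 * 4 * c ^ 2 - 2 * c ≤ 4 * (4 * c ^ 2)` for `c ≥
  -- 1`. Since `d` at least doubles, summing increments then costs at most `6`.
  have hD : ∀ i, s (i + 1) - s i ≤ 4 * d i ^ 2 := by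
    intro i
    induction i with
    | zero =>
      rw [hs0, zero_add, hs1]
      nlinarith [sq_nonneg (d 0)]
    | succ i ih =>
      rw [hsi, hdd]
      have h1 : 2 * c * (s (i + 1) - s i) ≤ 2 * c * (4 * d i ^ 2) :=
        mul_le_mul_of_nonneg_left ih (by linarith)
      have h2 : 0 ≤ (8 * c ^ 2 - 6 * c) * d i ^ 2 := mul_nonneg (by nlinarith) (sq_nonneg _)
      linarith
  change s (i + 1) ≤ 6 * d i ^ 2
  induction i with
  | zero =>
    rw [zero_add, hs1]
    nlinarith [sq_nonneg (d 0)]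
  | succ i ih =>
    have h1 := hD (i + 1)
    have h2 : 4 * d i ^ 2 ≤ d (i + 1) ^ 2 := by
      rw [hdd]
      exact mul_le_mul_of_nonneg_right (by nlinarith) (sq_nonneg _)
    linarith [sq_nonneg (d (i + 1))]

theorem IsAdditive.integral_exp_neg_le_of_const (hf : ∀ j, f j = 1) (hX0 : ∀ m j, 0 ≤ X m j)
    (i n : ℕ) :
    ∫ m, Real.exp (-(γ * c / (6 * (2 * c) ^ i) * X m (i + 1 + n)))
      ∂(criticalTokunaga c γ hc hγ).marksLaw ≤ (11 / 12) ^ 2 ^ n := by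
  have hcpos : 0 < c := by linarith
  have hθ : 0 ≤ γ * c / (6 * (2 * c) ^ i) := by positivity
  refine (hX.integral_exp_neg_add_le hX0 (fun j => by simp [hf]) hθ (i + 1) n).trans ?_
  refine pow_le_pow_left₀ (integral_nonneg fun _ => (Real.exp_pos _).le) ?_ _
  refine (hX.integral_exp_neg_le_quadratic hX0 hθ (i + 1)).trans ?_
  -- With mean at least `d` and second moment at most `6 * d ^ 2`, the choice `θ * d = 1 / 6` makes
  -- the quadratic bound `1 - 1 / 6 + 1 / 12 = 11 / 12`.
  have hθd : γ * c / (6 * (2 * c) ^ i) * ((2 * c) ^ i / (γ * c)) = 1 / 6 := by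
    field_simp
  have h1 : (2 * c) ^ i / (γ * c) ≤ (∫ m, X m (i + 1) ∂(criticalTokunaga c γ hc hγ).marksLaw) := by
    rw [← hX.increment_of_const hf i]
    have : 0 ≤ ∫ m, X m i ∂(criticalTokunaga c γ hc hγ).marksLaw :=
      integral_nonneg fun m => hX0 m i
    linarith
  have h2 := hX.integral_sq_le_of_const hf i
  set θ := γ * c / (6 * (2 * c) ^ i)
  set d := (2 * c) ^ i / (γ * c)
  have h3 := mul_le_mul_of_nonneg_left h1 hθ
  have h4 := mul_le_mul_of_nonneg_left h2 (show 0 ≤ θ ^ 2 / 2 by positivity)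
  have h5 : θ ^ 2 / 2 * (6 * d ^ 2) = 3 * (θ * d) ^ 2 := by ring
  rw [h5, hθd] at h4
  rw [hθd] at h3
  linarith

/-- The weight jumps by `1` at order `k` and by `-1` at `k + 1`. The value `2 ^ (-k)` is what makes
the second jump cancel the propagated increment exactly, after which the recursion stays at `0`. -/
theorem IsAdditive.increment_of_balanced {k : ℕ} (hk : 1 ≤ k)
    (hf : ∀ j, f j = (if j = k then 1 else 0) - (1 / 2) ^ k) (i : ℕ) :
    (∫ m, X m (i + 1) ∂(criticalTokunaga c γ hc hγ).marksLaw) -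
      (∫ m, X m i ∂(criticalTokunaga c γ hc hγ).marksLaw) = c ^ i / (γ * c) *
      (if i + 1 < k then -(2 ^ i * (1 / 2) ^ k) else if i + 1 = k then 1 / 2 else 0) := by
  induction i with
  | zero =>
    rw [hX.increment_zero, hf]
    rcases hk.eq_or_lt with rfl | hk
    · norm_num
      ring
    · simp only [zero_add, hk, hk.ne, if_true, if_false]
      ring
  | succ i ih =>
    rw [hX.increment_succ, ih, hf, hf]
    rcases lt_trichotomy (i + 2) k with h | h | h
    · simp only [show i + 1 < k by omega, show i + 1 + 1 < k by omega, show i + 2 ≠ k by omega,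
        show i + 1 ≠ k by omega, if_true, if_false]
      ring
    · subst h
      simp only [show i + 1 < i + 2 by omega, show ¬ i + 1 + 1 < i + 2 by omega,
        show i + 1 ≠ i + 2 by omega, if_true, if_false]
      have h2 : (2 : ℝ) ^ i * (1 / 2) ^ (i + 2) = 1 / 4 := by
        rw [pow_add, ← mul_assoc, ← mul_pow]
        norm_num
      rw [h2]
      ring
    · rcases eq_or_ne (i + 1) k with h' | h'
      · subst h'
        simp only [lt_irrefl, show ¬ i + 1 + 1 < i + 1 by omega, show i + 2 ≠ i + 1 by omega,
          if_true, if_false]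
        ring
      · simp only [show ¬ i + 1 < k by omega, show ¬ i + 1 + 1 < k by omega,
          show i + 2 ≠ k by omega, h', if_false]
        ring

theorem IsAdditive.exists_integral_sq_le_of_balanced {k : ℕ} (hk : 1 ≤ k)
    (hf : ∀ j, f j = (if j = k then 1 else 0) - (1 / 2) ^ k) :
    ∃ C, 0 ≤ C ∧ ∀ n, ∫ m, X m (k + n) ^ 2 ∂(criticalTokunaga c γ hc hγ).marksLaw ≤
      C * (2 * c) ^ n := by
  set s : ℕ → ℝ := fun i => ∫ m, X m i ^ 2 ∂(criticalTokunaga c γ hc hγ).marksLaw with hs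
  have hd : ∀ n, (∫ m, X m (k + n + 1) ∂(criticalTokunaga c γ hc hγ).marksLaw) -
      (∫ m, X m (k + n) ∂(criticalTokunaga c γ hc hγ).marksLaw) = 0 := fun n => by
    rw [hX.increment_of_balanced hk hf, if_neg (by omega), if_neg (by omega), mul_zero]
  have hsn : ∀ n, s (k + n + 1 + 1) - s (k + n + 1) = 2 * c * (s (k + n + 1) - s (k + n)) :=
    fun n => by
      have h := hX.sq_increment_succ (k + n)
      have hd' := hd (n + 1)
      rw [← add_assoc] at hd'
      rw [hd n, hd'] at h
      simp only [hs]
      linear_combination h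
  set κ := s (k + 1) - 2 * c * s k with hκ
  have hstep : ∀ n, s (k + n + 1) = 2 * c * s (k + n) + κ := by
    intro n
    induction n with
    | zero =>
      rw [hκ, add_zero]
      ring
    | succ n ih =>
      have := hsn n
      rw [← add_assoc]
      linarith
  have hs0 : 0 ≤ s k := integral_nonneg fun _ => sq_nonneg _
  refine ⟨s k + |κ|, by positivity, fun n => ?_⟩
  -- The induction needs the slack `-|κ|` to absorb `κ` at each step; `2 * c ≥ 2` makes this enough.
  suffices h : s (k + n) ≤ (s k + |κ|) * (2 * c) ^ n - |κ| from
    h.trans (by linarith [abs_nonneg κ])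
  induction n with
  | zero => simp
  | succ n ih =>
    have h1 := mul_le_mul_of_nonneg_left ih (show 0 ≤ 2 * c by linarith)
    have h2 : 0 ≤ (2 * c - 2) * |κ| := mul_nonneg (by linarith) (abs_nonneg κ)
    rw [← add_assoc, hstep n, pow_succ]
    linarith [le_abs_self κ]

end asymptotics

/-! ### The sampling probability as a mean length ratio -/

/-- The total length of the edges of order `k`. -/
noncomputable def orderLength (k : ℕ) (m : Marks) (j : ℕ) : ℝ≥0∞ :=
  total (lengthWeight fun i => if i = k then 1 else 0) m j

/-- The total length of all edges. -/
noncomputable def fullLength (m : Marks) (j : ℕ) : ℝ≥0∞ :=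
  total (lengthWeight fun _ => 1) m j

theorem orderLength_le_fullLength (k : ℕ) (m : Marks) (j : ℕ) :
    orderLength k m j ≤ fullLength m j :=
  total_mono (fun i x => by
    unfold lengthWeight
    dsimp only
    gcongr
    split_ifs <;> simp) m j

theorem measurable_orderLength (k j : ℕ) : Measurable fun m => orderLength k m j :=
  Params.measurable_total_right (measurable_lengthWeight _) j

theorem measurable_fullLength (j : ℕ) : Measurable fun m => fullLength m j :=
  Params.measurable_total_right (measurable_lengthWeight _) j

theorem inv_mul_orderLength_le_one (k : ℕ) (m : Marks) (j : ℕ) :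
    (fullLength m j)⁻¹ * orderLength k m j ≤ 1 := by
  rw [mul_comm, ← div_eq_mul_inv]
  exact ENNReal.div_le_of_le_mul (by simpa using orderLength_le_fullLength k m j)

namespace Params

variable (P : Params)

theorem tree_eq_of_generates {ω : Sample} {t : LengthTree} (h : Generates ω.2 [] ω.1 t) :
    tree ω = some t := by
  have hex : ∃ t, Generates ω.2 [] ω.1 t := ⟨t, h⟩
  rw [tree, dif_pos hex, hex.choose_spec.unique h]

theorem fst_eq_of_mem_orderEvent {ω : Sample} {K : ℕ} (h : ω ∈ orderEvent K) : ω.1 = K := by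
  obtain ⟨t, ht, htK⟩ := h
  by_cases hex : ∃ t, Generates ω.2 [] ω.1 t
  · obtain ⟨t', ht'⟩ := hex
    rw [tree_eq_of_generates ht', Option.some_inj] at ht
    rw [← htK, ← ht, ht'.order_eq]
  · simp [tree, hex] at ht

/-- Almost surely the tree exists, so the order event is `{K} ×ˢ Set.univ` up to a null set.
Conditioning the product law on it fixes the root order and leaves the law of the marks unchanged.
-/
theorem probPointOrder_eq_lintegral {K : ℕ} (hK : P.p K ≠ 0) (k : ℕ) :
    P.probPointOrder K k = ∫⁻ m, (fullLength m K)⁻¹ * orderLength k m K ∂P.marksLaw := by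
  have hK1 : 1 ≤ K := Nat.one_le_iff_ne_zero.2 fun h => hK (h ▸ P.p_zero)
  have hlaw : P.law = P.p.toMeasure.prod P.marksLaw := rfl
  have hgood : ∀ᵐ ω ∂P.law, total countWeight ω.2 K ≠ ∞ := by
    rw [hlaw]
    exact Measure.quasiMeasurePreserving_snd.ae (P.ae_count_ne_top K)
  have hms : MeasurableSet ({K} ×ˢ Set.univ : Set Sample) :=
    (measurableSet_singleton K).prod .univ
  have hevent : orderEvent K =ᵐ[P.law] ({K} ×ˢ Set.univ : Set Sample) := by
    filter_upwards [hgood] with ω hω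
    refine propext ⟨fun h => ⟨fst_eq_of_mem_orderEvent h, trivial⟩, fun h => ?_⟩
    obtain rfl : ω.1 = K := h.1
    obtain ⟨t, ht⟩ := exists_generates hK1 hω
    exact ⟨t, tree_eq_of_generates ht, ht.order_eq⟩
  have hpK : P.p.toMeasure {K} = P.p K :=
    PMF.toMeasure_apply_singleton _ _ (measurableSet_singleton K)
  have hmeas : Measurable fun ω : Sample => (fullLength ω.2 K)⁻¹ * orderLength k ω.2 K :=
    ((measurable_fullLength K).inv.mul (measurable_orderLength k K)).comp measurable_snd
  rw [probPointOrder, ProbabilityTheory.cond, lintegral_smul_measure,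
    Measure.restrict_congr_set hevent, measure_congr hevent,
    setLIntegral_congr_fun_ae (g := fun ω => (fullLength ω.2 K)⁻¹ * orderLength k ω.2 K) hms ?_]
  · rw [hlaw, ← Measure.prod_restrict, Measure.prod_prod, hpK, Measure.restrict_univ, measure_univ,
      mul_one, Measure.restrict_singleton, hpK, Measure.prod_smul_left, lintegral_smul_measure,
      Measure.dirac_prod, lintegral_map hmeas measurable_prodMk_left, smul_eq_mul, smul_eq_mul,
      ← mul_assoc, ENNReal.inv_mul_cancel hK (P.p.apply_ne_top K), one_mul]
  · filter_upwards [hgood] with ω hω hmem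
    obtain rfl : ω.1 = K := hmem.1
    obtain ⟨t, ht⟩ := exists_generates hK1 hω
    rw [tree_eq_of_generates ht, Option.elim_some, LengthTree.uniformMeasure_pointOrder,
      ← ht.total_lengthWeight, ← ht.total_lengthWeight, marksAt_nil]
    rfl

end Params

/-! ### Concentration of the ratio and the limit -/

theorem sq_inv_mul_sub_le {θ x a p : ℝ} (ha : 0 ≤ a) (hax : a ≤ x) (hp0 : 0 ≤ p)
    (hp1 : p ≤ 1) :
    (x⁻¹ * a - p) ^ 2 ≤ θ ^ 2 * (a - p * x) ^ 2 + Real.exp 1 * Real.exp (-(θ * x)) := by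
  have hx : 0 ≤ x := ha.trans hax
  -- If `x` is large, `x⁻¹ ≤ θ` gives the first term. Otherwise the left side is at most `1`, which
  -- the second term exceeds; this includes `x = 0`, where `x⁻¹ = 0`.
  rcases le_total 1 (θ * x) with h | h
  · have hx0 : 0 < x := hx.lt_of_ne fun h0 => by
      rw [← h0, mul_zero] at h
      linarith
    have h1 : x⁻¹ * a - p = x⁻¹ * (a - p * x) := by
      field_simp
    have h2 : x⁻¹ ≤ θ := by
      rw [inv_le_iff_one_le_mul₀ hx0]
      exact h
    have h3 : x⁻¹ ^ 2 ≤ θ ^ 2 := pow_le_pow_left₀ (by positivity) h2 2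
    rw [h1, mul_pow]
    have := mul_le_mul_of_nonneg_right h3 (sq_nonneg (a - p * x))
    have h4 : 0 ≤ Real.exp 1 * Real.exp (-(θ * x)) := by positivity
    linarith
  · have h1 : 1 ≤ Real.exp 1 * Real.exp (-(θ * x)) := by
      rw [← Real.exp_add]
      exact Real.one_le_exp (by linarith)
    have h2 : 0 ≤ x⁻¹ * a := by positivity
    have h3 : x⁻¹ * a ≤ 1 := by
      rw [mul_comm, ← div_eq_mul_inv]
      exact div_le_one_of_le₀ hax hx
    have h4 : (x⁻¹ * a - p) ^ 2 ≤ 1 := by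
      rw [sq_le_one_iff_abs_le_one, abs_le]
      constructor <;> linarith
    have h5 : 0 ≤ θ ^ 2 * (a - p * x) ^ 2 := by positivity
    linarith

section criticalTokunaga

variable {c γ : ℝ} (hc : 1 ≤ c) (hγ : 0 < γ)

theorem isAdditive_fullLength (P : Params) :
    IsAdditive P (fun _ => 1) (fun m j => (fullLength m j).toReal) := by
  simpa [fullLength] using P.isAdditive_length (g := fun _ => 1) fun _ => le_rfl

theorem isAdditive_balancedLength (P : Params) (k : ℕ) :
    IsAdditive P (fun j => (if j = k then 1 else 0) - (1 / 2) ^ k)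
      (fun m j => (orderLength k m j).toReal - (1 / 2) ^ k * (fullLength m j).toReal) := by
  have h := (P.isAdditive_length (g := fun j => if j = k then 1 else 0)
    fun _ => by split_ifs <;> simp).add ((isAdditive_fullLength P).const_mul (-(1 / 2) ^ k))
  convert h using 2
  · rw [apply_ite ENNReal.toReal]
    simp [sub_eq_add_neg]
  · simp [sub_eq_add_neg, orderLength]

theorem sq_integral_ratio_sub_le (P : Params) (k j : ℕ) {θ : ℝ} (hθ : 0 ≤ θ) :
    (∫ m, ((fullLength m j)⁻¹ * orderLength k m j).toReal ∂P.marksLaw - (1 / 2) ^ k) ^ 2 ≤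
      θ ^ 2 * ∫ m, ((orderLength k m j).toReal - (1 / 2) ^ k * (fullLength m j).toReal) ^ 2
        ∂P.marksLaw +
      Real.exp 1 * ∫ m, Real.exp (-(θ * (fullLength m j).toReal)) ∂P.marksLaw := by
  have hrm : Measurable fun m => ((fullLength m j)⁻¹ * orderLength k m j).toReal :=
    ((measurable_fullLength j).inv.mul (measurable_orderLength k j)).ennreal_toReal
  have hr : MemLp (fun m => ((fullLength m j)⁻¹ * orderLength k m j).toReal) 2 P.marksLaw :=
    MemLp.of_bound hrm.aestronglyMeasurable 1 (ae_of_all _ fun m => by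
      rw [Real.norm_of_nonneg ENNReal.toReal_nonneg]
      exact ENNReal.toReal_le_of_le_ofReal zero_le_one
        (by simpa using inv_mul_orderLength_le_one k m j))
  have hd : MemLp (fun m => ((fullLength m j)⁻¹ * orderLength k m j).toReal - (1 / 2) ^ k) 2
      P.marksLaw := hr.sub (memLp_const _)
  -- Nonnegative variance serves as Jensen's inequality for the square.
  have hvar := variance_nonneg
    (fun m => ((fullLength m j)⁻¹ * orderLength k m j).toReal - (1 / 2) ^ k) P.marksLaw
  rw [variance_eq_sub hd, integral_sub (hr.integrable one_le_two) (integrable_const _)] at hvar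
  simp only [integral_const, probReal_univ, one_smul, Pi.pow_apply] at hvar
  refine (sub_nonneg.1 hvar).trans ?_
  have hX := isAdditive_balancedLength P k
  have hexp := (isAdditive_fullLength P).integrable_exp_neg
    (fun _ _ => ENNReal.toReal_nonneg) hθ j
  rw [← integral_const_mul, ← integral_const_mul,
    ← integral_add ((hX.memLp j).integrable_sq.const_mul _) (hexp.const_mul _)]
  refine integral_mono_ae hd.integrable_sq
    (((hX.memLp j).integrable_sq.const_mul _).add (hexp.const_mul _)) ?_
  filter_upwards [P.ae_length_ne_top (g := fun _ => 1) (fun _ => le_rfl) j] with m hm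
  have hle := orderLength_le_fullLength k m j
  rw [ENNReal.toReal_mul, ENNReal.toReal_inv]
  exact sq_inv_mul_sub_le ENNReal.toReal_nonneg (ENNReal.toReal_mono hm hle)
    (by positivity) (pow_le_one₀ (by norm_num) (by norm_num))

theorem exists_sq_integral_ratio_sub_le {k : ℕ} (hk : 1 ≤ k) (n : ℕ) :
    ∃ C : ℝ, ∀ i, k ≤ i →
      (∫ m, ((fullLength m (i + 1 + n))⁻¹ * orderLength k m (i + 1 + n)).toReal
        ∂(criticalTokunaga c γ hc hγ).marksLaw - (1 / 2) ^ k) ^ 2 ≤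
      C * (1 / 2) ^ i + Real.exp 1 * (11 / 12) ^ 2 ^ n := by
  have hcpos : 0 < c := by linarith
  obtain ⟨C, hC, hbound⟩ :=
    (isAdditive_balancedLength (criticalTokunaga c γ hc hγ) k).exists_integral_sq_le_of_balanced
      hk fun _ => rfl
  -- From `θ ^ 2` of order `(2 * c) ^ (-2 * i)` and a second moment of order `(2 * c) ^ (i + 1 +
  -- n)`; the constant depends on `n` but not on `i`.
  refine ⟨(γ * c / 6) ^ 2 * (C * (2 * c) ^ (1 + n)), fun i hi => ?_⟩
  have hθ : 0 ≤ γ * c / (6 * (2 * c) ^ i) := by positivity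
  refine (sq_integral_ratio_sub_le _ k (i + 1 + n) hθ).trans (add_le_add ?_ ?_)
  · have h := hbound (i + 1 + n - k)
    rw [show k + (i + 1 + n - k) = i + 1 + n by omega] at h
    have h1 : (2 * c) ^ (i + 1 + n - k) ≤ (2 * c) ^ (i + (1 + n)) :=
      pow_le_pow_right₀ (by linarith) (by omega)
    have h2 : (1 / (2 * c)) ^ i ≤ (1 / 2 : ℝ) ^ i :=
      pow_le_pow_left₀ (by positivity) (one_div_le_one_div_of_le two_pos (by linarith)) i
    calc _ ≤ (γ * c / (6 * (2 * c) ^ i)) ^ 2 * (C * (2 * c) ^ (i + (1 + n))) :=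
          mul_le_mul_of_nonneg_left (h.trans (mul_le_mul_of_nonneg_left h1 hC)) (sq_nonneg _)
      _ = (γ * c / 6) ^ 2 * (C * (2 * c) ^ (1 + n)) * (1 / (2 * c)) ^ i := by
          rw [pow_add (2 * c) i, one_div, inv_pow]
          field_simp
      _ ≤ _ := mul_le_mul_of_nonneg_left h2 (by positivity)
  · exact mul_le_mul_of_nonneg_left
      ((isAdditive_fullLength (criticalTokunaga c γ hc hγ)).integral_exp_neg_le_of_const
        (fun _ => rfl) (fun _ _ => ENNReal.toReal_nonneg) i n) (Real.exp_pos 1).le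

theorem tendsto_integral_ratio {k : ℕ} (hk : 1 ≤ k) :
    Tendsto (fun K => ∫ m, ((fullLength m K)⁻¹ * orderLength k m K).toReal
      ∂(criticalTokunaga c γ hc hγ).marksLaw) atTop (𝓝 ((1 / 2) ^ k)) := by
  rw [Metric.tendsto_atTop]
  intro ε hε
  have hε2 : 0 < ε ^ 2 / 2 := by positivity
  have hn : Tendsto (fun n : ℕ => Real.exp 1 * (11 / 12 : ℝ) ^ 2 ^ n) atTop (𝓝 0) := by
    have h := (tendsto_pow_atTop_nhds_zero_of_lt_one (r := (11 / 12 : ℝ)) (by norm_num)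
      (by norm_num)).comp (tendsto_pow_atTop_atTop_of_one_lt (r := 2) one_lt_two)
    simpa using h.const_mul (Real.exp 1)
  -- `n` has to be fixed before `i`, since `C` grows with `n`.
  obtain ⟨n, hn⟩ := (hn.eventually_lt_const hε2).exists
  obtain ⟨C, hC⟩ := exists_sq_integral_ratio_sub_le hc hγ hk n
  have hi : Tendsto (fun i : ℕ => C * (1 / 2 : ℝ) ^ i) atTop (𝓝 0) := by
    simpa using (tendsto_pow_atTop_nhds_zero_of_lt_one (r := (1 / 2 : ℝ)) (by norm_num)
      (by norm_num)).const_mul C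
  obtain ⟨N, hN⟩ := eventually_atTop.1 (hi.eventually_lt_const hε2)
  refine ⟨max N k + 1 + n, fun K hK => ?_⟩
  obtain ⟨i, rfl⟩ : ∃ i, K = i + 1 + n := ⟨K - (1 + n), by omega⟩
  have h1 := hC i (by omega)
  have h2 := hN i (by omega)
  rw [Real.dist_eq]
  refine abs_lt_of_sq_lt_sq ?_ hε.le
  linarith

end criticalTokunaga

end TreeProcess

theorem proposition12 (c γ : ℝ) (hc : 1 ≤ c) (hγ : 0 < γ) (k : ℕ) (hk : 1 ≤ k) :
    Tendsto (fun K : ℕ => (TreeProcess.criticalTokunaga c γ hc hγ).probPointOrder K k)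
      atTop (𝓝 ((2 : ℝ≥0∞)⁻¹ ^ k)) := by
  have hlim := (ENNReal.continuous_ofReal.tendsto _).comp
      (TreeProcess.tendsto_integral_ratio hc hγ hk)
  have hval : ENNReal.ofReal ((1 / 2) ^ k) = (2 : ℝ≥0∞)⁻¹ ^ k := by
    rw [ENNReal.ofReal_pow (by norm_num), one_div, ENNReal.ofReal_inv_of_pos two_pos]
    simp
  rw [hval] at hlim
  refine hlim.congr' ?_
  -- Order `0` has probability zero, so conditioning on it is excluded.
  filter_upwards [eventually_ge_atTop 1] with K hK
  have hp : (TreeProcess.criticalTokunaga c γ hc hγ).p K ≠ 0 := by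
    change (if K = 0 then (0 : ℝ≥0∞) else 2⁻¹ ^ K) ≠ 0
    rw [if_neg (by omega)]
    simp
  have htop : ∀ m, (TreeProcess.fullLength m K)⁻¹ * TreeProcess.orderLength k m K ≠ ∞ := fun m =>
    ((TreeProcess.inv_mul_orderLength_le_one k m K).trans_lt ENNReal.one_lt_top).ne
  have hmeas : Measurable fun m => (TreeProcess.fullLength m K)⁻¹ * TreeProcess.orderLength k m K :=
    (TreeProcess.measurable_fullLength K).inv.mul (TreeProcess.measurable_orderLength k K)
  rw [TreeProcess.Params.probPointOrder_eq_lintegral _ hp, Function.comp_apply, integral_toReal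
    hmeas.aemeasurable
    (ae_of_all _ fun m => (htop m).lt_top), ENNReal.ofReal_toReal]
  refine ((lintegral_mono fun m => TreeProcess.inv_mul_orderLength_le_one k m K).trans_lt ?_).ne
  simp
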